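/- **Conventions.** Let $K$ be a field of characteristic zero, $r\ge 1$, $\underline u=(u_1,\dots,u_r)$. Order $\mathbb N^r$ by $\le_{\rm grlex}$ (first total degree $|\cdot|$, then lexicographically from the first coordinate), let $S(\underline k)$ be the successor of $\underline k$ for this order, and for a nonzero $Q\in K[[\underline u]][y]$ let $w(Q)\in\mathbb N^r$ be the $\le_{\rm grlex}$-least exponent of $\underline u$ occurring in $Q$. For a finitely supported tuple of natural numbers $\underline m=(m_{\underline i,j})$ put $|\underline m|=\sum m_{\underline i,j}$, $\|\underline m\|=\sum m_{\underline i,j}\,j$, $g(\underline m)=\sum m_{\underline i,j}\,\underline i$, $\underline m!=\prod m_{\underline i,j}!$, and likewise $|\underline L|,g(\underline L),\underline L!$ for $\underline L=(l_{\underline i})$. Let $P(\underline u,y)=\sum_{\underline i\in\mathbb N^r}\sum_{j=0}^{d_y}a_{\underline i,j}\underline u^{\underline i}y^j\in K[[\underline u]][y]\setminus\{0\}$ have degree at most $d_y$ in $y$ and only simple roots (in an algebraic closure of $K((\underline u))$), let $\Delta_P=\mathrm{Res}(P,\partial P/\partial y)$, and let $y_0=\sum_{\underline n\in\mathbb N^r}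 c_{\underline n}\underline u^{\underline n}\in K[[\underline u]]$ be a root of $P$. For $\underline k\in\mathbb N^r$ put $$z_{\underline k}=\sum_{\underline n\le_{\rm grlex}\underline k}c_{\underline n}\underline u^{\underline n},\qquad P_{\underline k}(\underline u,y)=P(\underline u,z_{\underline k}+\underline u^{S(\underline k)}y)=\sum_{\underline i}\pi_{\underline k,\underline i}(y)\,\underline u^{\underline i},\qquad \underline i_{\underline k}=w(P_{\underline k}).$$ Let $\underline k_0$ be the lowest multi-index with $\underline i_{S(\underline k_0)}=\underline i_{\underline k_0}-S(\underline k_0)+S^2(\underline k_0)$, and $\omega_0=\pi_{\underline k_0,\underline i_{\underline k_0}}'(c_{S(\underline k_0)})$. **Statement.** The multi-index $\underline k_0$ exists and $\omega_0\neq0$. Let moreover $\underline k\in\mathbb N^r$ satisfy $|\underline k|\ge \mathrm{ord}_{\underline u}(\Delta_P)+1$, put $${}_{\underline k}Q(\underline u,y)=y+\frac{P_{\underline k}(\underline u,y+c_{S(\underline k)})}{-\omega_0\,\underline u^{\underline i_{\underline k}}}=\sum_{\underline l\in\mathbb Z^r,\,m}b_{\underline l,m}\underline u^{\underline l}y^m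 ,$$ let $\underline p\in\mathbb N^r$ with $\underline p>_{\rm grlex}S(\underline k)$, and let $\underline n=\underline p-S(\underline k)\in\mathbb Z^r$. The integers $q$ for which there is a finitely supported tuple $\underline M=(m_{\underline l,j})$ with $m_{\underline l,j}=0$ whenever $b_{\underline l,j}=0$, and with $|\underline M|=q$, $\|\underline M\|=q-1$, $g(\underline M)=\underline n$, are bounded above; let $\mu_{\underline n}$ be the greatest one ($\mu_{\underline n}=0$ if there is none). Then $$c_{S(\underline k)+\underline n}=\sum_{q=1}^{\mu_{\underline n}}\frac1q\left(\frac{-1}{\omega_0}\right)^q\sum_{|\underline S|=q,\ \|\underline S\|\ge q-1}\underline A^{\underline S}\left(\sum_{\substack{|\underline T|=\|\underline S\|-q+1\\ g(\underline T)=\underline n+q\underline i_{\underline k}-(q-1)S(\underline k)-g(\underline S)}}e_{\underline T}\,\underline C^{\underline T}\right).$$ Here $\underline S=(s_{\underline i,j})_{\underline i\in\mathbb N^r,\,0\le j\le d_y}$ and $\underline T=(t_{\underline i})_{\underline 0\le_{\rm grlex}\underline i\le_{\rm grlex}S(\underline k)}$ are tuples of natural numbers of finite support, $\underline A^{\underline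 S}=\prod a_{\underline i,j}^{s_{\underline i,j}}$, $\underline C^{\underline T}=\prod c_{\underline i}^{t_{\underline i}}$, and $e_{\underline T}$ (which depends on $q$ and $\underline S$ too) is $$e_{\underline T}=\sum_{N}\frac{q!}{\prod n^{\underline l,m}_{\underline i,j,\underline L}!}\prod\left(\frac{j!}{m!\,\underline L!}\right)^{n^{\underline l,m}_{\underline i,j,\underline L}},$$ the products running over all indices $(\underline l,m,\underline i,j,\underline L)$ with $\underline l+\underline i_{\underline k}\in\mathbb N^r$, $\underline l+\underline i_{\underline k}\ge_{\rm grlex}S(\underline i_{\underline k})$, $0\le m\le m_{\underline l}:=\min\{d_y,\max\{m\in\mathbb N: mS(\underline k)\le_{\rm grlex}\underline l+\underline i_{\underline k}\}\}$, $\underline i\in\mathbb N^r$, $m\le j\le d_y$, $\underline L=(l_{\underline 0},\dots,l_{S(\underline k)})$, $|\underline L|=j-m$, $g(\underline L)=\underline l+\underline i_{\underline k}-mS(\underline k)-\underline i$, and the sum running over the finitely supported tuples $N=(n^{\underline l,m}_{\underline i,j,\underline L})$ of natural numbers with $$\sum_{\underline l,m}\sum_{\underline L}n^{\underline l,m}_{\underline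 i,j,\underline L}=s_{\underline i,j}\ (\forall\,\underline i,j),\qquad \sum n^{\underline l,m}_{\underline i,j,\underline L}=q,\qquad \sum n^{\underline l,m}_{\underline i,j,\underline L}\,\underline L=\underline T .$$ For every $q\ge1$ there are only finitely many pairs $(\underline S,\underline T)$ as in the sum, for each of them only finitely many $N$, and $\frac1q e_{\underline T}\in\mathbb N$ (in particular $e_{\underline T}\in\mathbb N$). -/

import Mathlib

noncomputable section

namespace ClosedForm

/-- Exponents `n ∈ ℕ^r`. They are compared with the graded lexicographic order: total degree first,
then lexicographically from the first coordinate on. This is Mathlib's order on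
`DegLex (Fin r →₀ ℕ)`, reached through `toDegLex`. -/
abbrev Expo (r : ℕ) := Fin r →₀ ℕ

/-- `K[[u_1, …, u_r]]`. -/
abbrev PS (r : ℕ) (K : Type*) := MvPowerSeries (Fin r) K

variable {r : ℕ} {K : Type*} [Field K]

/-- An exponent of `ℕ^r` seen in `ℤ^r`. -/
def toZ (n : Expo r) : Fin r → ℤ := fun t => (n t : ℤ)

open Classical in
/-- The least element, for the graded lexicographic order, of a nonempty set of exponents
(and `0` for the empty set). -/
def grMin (A : Set (Expo r)) : Expo r :=
  if h : A.Nonempty then Function.argminOn (toDegLex : Expo r → DegLex (Expo r)) A h else 0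

/-- The successor `S(k)` of `k` in `ℕ^r` for the graded lexicographic order (for `r ≥ 1`). -/
def grSucc (k : Expo r) : Expo r := grMin {m | toDegLex k < toDegLex m}

/-- The discriminant, with the convention `Δ_P = Res(P, ∂P/∂y)`. -/
def discrim (P : Polynomial (PS r K)) : PS r K := P.resultant P.derivative

/-- All the roots of `P` in an algebraic closure of the fraction field of `K[[u]]` are simple. -/
def OnlySimpleRoots (P : Polynomial (PS r K)) : Prop :=
  (P.aroots (AlgebraicClosure (FractionRing (PS r K)))).Nodup

/-- The initial part `z_k = ∑_{n ≤ k} c_n u^n` of `y₀ = ∑ c_n u^n`. -/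
def initialPart (y₀ : PS r K) (k : Expo r) : PS r K :=
  fun n => if toDegLex n ≤ toDegLex k then MvPowerSeries.coeff n y₀ else 0

/-- `P_k(u, y) = P(u, z_k + u^{S(k)} y)`. -/
def shifted (P : Polynomial (PS r K)) (y₀ : PS r K) (k : Expo r) : Polynomial (PS r K) :=
  P.comp (Polynomial.C (initialPart y₀ k) +
    Polynomial.C (MvPowerSeries.monomial (grSucc k) (1 : K)) * Polynomial.X)

/-- The graded lexicographic valuation `w(Q)` of a nonzero `Q ∈ K[[u]][y]`: the least exponent of
`u` that occurs in one of the coefficients of `Q`. -/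
def val (Q : Polynomial (PS r K)) : Expo r :=
  grMin {n | ∃ j : ℕ, MvPowerSeries.coeff n (Q.coeff j) ≠ 0}

/-- `i_k = w(P_k)`. -/
def iota (P : Polynomial (PS r K)) (y₀ : PS r K) (k : Expo r) : Expo r :=
  val (shifted P y₀ k)

/-- `π_i^Q(y) ∈ K[y]`, the coefficient of `u^i` in `Q(u, y)`. -/
def piCoeff (Q : Polynomial (PS r K)) (i : Expo r) : Polynomial K :=
  ∑ j ∈ Q.support, Polynomial.monomial j (MvPowerSeries.coeff i (Q.coeff j))

/-- The lowest multi-index `k₀` such that `i_{S(k₀)} = i_{k₀} - S(k₀) + S(S(k₀))`. -/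
def kZero (P : Polynomial (PS r K)) (y₀ : PS r K) : Expo r :=
  grMin {k | iota P y₀ (grSucc k) + grSucc k = iota P y₀ k + grSucc (grSucc k)}

/-- `ω₀ = (π_{k₀, i_{k₀}})'(c_{S(k₀)})`, where `π_{k, i}` is the coefficient of `u^i` in `P_k`. -/
def omegaZero (P : Polynomial (PS r K)) (y₀ : PS r K) : K :=
  (piCoeff (shifted P y₀ (kZero P y₀)) (iota P y₀ (kZero P y₀))).derivative.eval
    (MvPowerSeries.coeff (grSucc (kZero P y₀)) y₀)

open Classical in
/-- The coefficient of `u^l y^m` (with `l ∈ ℤ^r`, `m ∈ ℕ`) in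
`R_k(u, y) = P_k(u, y + c_{S(k)}) / (-ω₀ u^{i_k})`, a polynomial in `y` over the series in `u` with
exponents in `ℤ^r`. -/
def coeffR (P : Polynomial (PS r K)) (y₀ : PS r K) (k : Expo r) (l : Fin r → ℤ) (m : ℕ) : K :=
  if h : ∃ n : Expo r, toZ n = l + toZ (iota P y₀ k) then
    MvPowerSeries.coeff h.choose
      (((shifted P y₀ k).comp (Polynomial.X + Polynomial.C
        (MvPowerSeries.C (MvPowerSeries.coeff (grSucc k) y₀)))).coeff m) / (-omegaZero P y₀)
  else 0

/-- The coefficient of `u^l y^m` in `Q_k(u, y) = y + R_k(u, y)`. -/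
def coeffQ (P : Polynomial (PS r K)) (y₀ : PS r K) (k : Expo r) (l : Fin r → ℤ) (m : ℕ) : K :=
  coeffR P y₀ k l m + if l = 0 ∧ m = 1 then 1 else 0

/-- `‖M‖ = ∑ m_{i,j} j`. (The sum `|M| = ∑ m_{i,j}` is Mathlib's `Finsupp.degree M`.) -/
def yWeight {α : Type*} (M : (α × ℕ) →₀ ℕ) : ℕ := M.sum fun x c => c * x.2

/-- `g(M) = ∑ m_{i,j} i`. -/
def gPair {α : Type*} [AddCommMonoid α] (M : (α × ℕ) →₀ ℕ) : α := M.sum fun x c => c • x.1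

/-- `g(L) = ∑ l_i i`. -/
def gSingle (L : Expo r →₀ ℕ) : Expo r := L.sum fun i c => c • i

/-- `L! = ∏ l_i!`. -/
def factProd {α : Type*} (L : α →₀ ℕ) : ℕ := L.prod fun _ c => c.factorial

/-- The integers `q` for which there is a tuple `M = (m_{l,j})`, supported on the monomials
`u^l y^j` occurring in `Q_k`, with `|M| = q`, `‖M‖ = q - 1` and `g(M) = n`. -/
def muSet (P : Polynomial (PS r K)) (y₀ : PS r K) (k : Expo r) (n : Fin r → ℤ) : Set ℕ :=
  {q | ∃ M : ((Fin r → ℤ) × ℕ) →₀ ℕ, (∀ x ∈ M.support, coeffQ P y₀ k x.1 x.2 ≠ 0) ∧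
    M.degree = q ∧ yWeight M + 1 = q ∧ gPair M = n}

/-- `μ_n`, the greatest element of `muSet` (and `0` if there is none). -/
def mu (P : Polynomial (PS r K)) (y₀ : PS r K) (k : Expo r) (n : Fin r → ℤ) : ℕ :=
  sSup (muSet P y₀ k n)

/-- The tuples `S = (s_{i,j})`, `i ∈ ℕ^r`, `0 ≤ j ≤ d`, of finite support with `|S| = q` and
`‖S‖ ≥ q - 1`. -/
def SIndex (r d q : ℕ) : Set ((Expo r × ℕ) →₀ ℕ) :=
  {S | (∀ x ∈ S.support, x.2 ≤ d) ∧ S.degree = q ∧ q ≤ yWeight S + 1}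

/-- The tuples `T = (t_i)_{0 ≤ i ≤ Sk}` with `|T| = ‖S‖ - q + 1` and
`g(T) = n + q ι - (q - 1) Sk - g(S)`. -/
def TIndex (Sk ι : Expo r) (n : Fin r → ℤ) (q : ℕ) (S : (Expo r × ℕ) →₀ ℕ) :
    Set (Expo r →₀ ℕ) :=
  {T | (∀ i ∈ T.support, toDegLex i ≤ toDegLex Sk) ∧
    T.degree + q = yWeight S + 1 ∧
    toZ (gSingle T) = n + (q : ℤ) • toZ ι - ((q : ℤ) - 1) • toZ Sk - toZ (gPair S)}

/-- `m_l = min {d, max {m | m Sk ≤ l + ι}}`, as a function of `lhat = l + ι`. -/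
def mBound (d : ℕ) (Sk lhat : Expo r) : ℕ :=
  min d (sSup {m : ℕ | toDegLex (m • Sk) ≤ toDegLex lhat})

/-- An index `(l, m, i, j, L)` of the tuples `(n^{l,m}_{i,j,L})`. The exponent `l ∈ -ι + ℕ^r` is
recorded through `lhat = l + ι ∈ ℕ^r`. -/
structure EIdx (r : ℕ) where
  lhat : Expo r
  m : ℕ
  i : Expo r
  j : ℕ
  L : Expo r →₀ ℕ

/-- The range of the indices: `l ≥ S(ι) - ι`, `0 ≤ m ≤ m_l`, `m ≤ j ≤ d`, and `L = (l_i)_{0 ≤ i ≤ Sk}`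
with `|L| = j - m` and `g(L) = l + ι - m Sk - i`. -/
def EIdx.Admissible (d : ℕ) (Sk ι : Expo r) (x : EIdx r) : Prop :=
  toDegLex (grSucc ι) ≤ toDegLex x.lhat ∧
  x.m ≤ mBound d Sk x.lhat ∧
  x.m ≤ x.j ∧ x.j ≤ d ∧
  (∀ i ∈ x.L.support, toDegLex i ≤ toDegLex Sk) ∧
  x.L.degree = x.j - x.m ∧
  toZ (gSingle x.L) = toZ x.lhat - (x.m : ℤ) • toZ Sk - toZ x.i

/-- The tuples `N = (n^{l,m}_{i,j,L})` of natural numbers with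
`∑_{l,m} ∑_L n^{l,m}_{i,j,L} = s_{i,j}` for all `i, j`, with `∑ n^{l,m}_{i,j,L} = q` and with
`∑ n^{l,m}_{i,j,L} L = T`. -/
def ETuples (d : ℕ) (Sk ι : Expo r) (q : ℕ) (S : (Expo r × ℕ) →₀ ℕ) (T : Expo r →₀ ℕ) :
    Set (EIdx r →₀ ℕ) :=
  {N | (∀ x ∈ N.support, x.Admissible d Sk ι) ∧
    (N.mapDomain fun x => (x.i, x.j)) = S ∧
    N.degree = q ∧
    (N.sum fun x c => c • x.L) = T}

/-- The coefficient `e_T = ∑_N q! / ∏ n^{l,m}_{i,j,L}! · ∏ (j! / (m! L!)) ^ n^{l,m}_{i,j,L}`. -/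
def eCoeff (d : ℕ) (Sk ι : Expo r) (q : ℕ) (S : (Expo r × ℕ) →₀ ℕ) (T : Expo r →₀ ℕ) : ℚ :=
  ∑ᶠ N ∈ ETuples d Sk ι q S T,
    ((q.factorial : ℚ) / (factProd N : ℚ)) *
      N.prod fun x c =>
        ((x.j.factorial : ℚ) / ((x.m.factorial : ℚ) * (factProd x.L : ℚ))) ^ c

/-- `A^S = ∏ a_{i,j}^{s_{i,j}}`, where `a_{i,j}` is the coefficient of `u^i y^j` in `P`. -/
def monA (P : Polynomial (PS r K)) (S : (Expo r × ℕ) →₀ ℕ) : K :=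
  S.prod fun x c => MvPowerSeries.coeff x.1 (P.coeff x.2) ^ c

/-- `C^T = ∏ c_i^{t_i}`, where `c_i` is the coefficient of `u^i` in `y₀`. -/
def monC (y₀ : PS r K) (T : Expo r →₀ ℕ) : K :=
  T.prod fun i c => MvPowerSeries.coeff i y₀ ^ c

end ClosedForm

end

/-!
Let `D = P'(y₀)`, with first term `ω u^δ` for the graded lexicographic order. As `D` divides the
discriminant, `|δ| ≤ ord Δ_P`. When `S(k)` exceeds `δ`, Taylor expansion at `y₀` shows that
`P_k(u, y + c_{S(k)})` starts with `ω y u^{δ + S(k)}` (`centred_leading`), so `i_k = δ + S(k)` and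
`k` satisfies the condition defining `k₀`. Conversely, for any index satisfying this condition,
the coefficient of `y` in the first term of `P_k(u, y + c_{S(k)})` is nonzero and equals `ω`
(`leading_of_iota_grSucc`): otherwise the first term of `P_{S(k)}` would be free of `y`, which is
impossible because `P_{S(k)}` has a root without exponents below `0`. Hence `k₀` exists and
`ω₀ = ω ≠ 0` (`kZero_spec`).

In the ring of Hahn series with exponents in `ℤ^r`, the remainder `ζ = (y₀ - z_{S(k)}) / u^{S(k)}`
is thus a solution of `ζ = Q_k(u, ζ)`, where all the exponents of `Q_k` are positive. The
lexicographic order is not Archimedean, but only exponents beyond `i_k` and `S(k)` matter, and on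
those it can be replaced by a linear form on `ℤ^r` with positive integral coefficients
(`exists_weight`). For this weight, `Q_k` has its exponents in weights `≥ 1`, so modulo large
weights it is nilpotent, and there Lagrange inversion `ζ = ∑ (1/q) [y^{q-1}] Q_k^q` is a finite
polynomial identity (`eq_sum_coeff_pow_of_eval_eq`, `coeff_eq_sum_coeff_pow`). The weight of `n`
also bounds `μ_n`, and the powers `q > μ_n` do not contribute by definition of `μ_n`.

It remains to expand. The coefficients of `Q_k` are sums of monomials in the coefficients of `P`
and `y₀` over the admissible indices `(l, m, i, j, L)` (`coeffQ_eq_sum_term`); the power `Q_k^q` is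
expanded multinomially over tuples `N` of such indices, and the tuples contributing to
`u^n y^{q-1}` are grouped according to `(S, T)` (`sum_NTuples_eq_finsum`). For such tuples
`∑ N m = q - 1`, so that `q` divides their multinomial coefficients
(`dvd_multinomial_of_weight`); this gives the integrality of `e_T / q`.
-/

namespace ClosedForm

/-! ### Lagrange inversion over a ring with nilpotent data -/

open Polynomial in
/-- Lagrange inversion for a nilpotent polynomial `Q`: a root `ζ` of `y = Q(y)` is
`∑ (1/q) [y^{q-1}] Q^q`. With `H = ∑ Q^q X^{N-q}`, which inverts `X - Q` up to `X^{N+1}`, the sum is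
the coefficient of `X^N` in `H (Q - X Q')`; the factorization `X - Q = (X - ζ) V` evaluates it. -/
theorem eq_sum_coeff_pow_of_eval_eq {F R : Type*} [Field F] [CharZero F] [CommRing R]
    [Algebra F R] {Q : R[X]} {ζ : R} (hζ : Q.eval ζ = ζ) {N : ℕ} (hN : Q ^ (N + 1) = 0) :
    ζ = ∑ q ∈ Finset.Icc 1 N, (1 / (q : F)) • (Q ^ q).coeff (q - 1) := by
  have hζN : ζ ^ (N + 1) = 0 := by
    rw [← hζ, ← eval_pow, hN, eval_zero]
  obtain rfl | hN0 := Nat.eq_zero_or_pos N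
  · simpa using hζN
  -- `V` is defined by `X - Q = (X - ζ) V`; it is `1` modulo nilpotents.
  obtain ⟨V, hV⟩ : (X - C ζ) ∣ (X - Q) := dvd_iff_isRoot.2 (by simp [hζ])
  have hVu : IsUnit V := by
    have hnil : IsNilpotent (X * (V - 1)) := by
      have : X * (V - 1) = V * C ζ - Q := by linear_combination (-1 : R[X]) * hV
      rw [this]
      refine (Commute.all _ _).isNilpotent_sub ((Commute.all _ _).isNilpotent_mul_left ?_)
        ⟨N + 1, hN⟩
      exact ⟨N + 1, by rw [← C_pow, hζN, C_0]⟩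
    obtain ⟨n, hn⟩ := hnil
    rw [mul_pow] at hn
    have h1 : (V - 1) ^ n = 0 := (monic_X_pow n).isRegular.left (by simpa using hn)
    have := (show IsNilpotent (V - 1) from ⟨n, h1⟩).isUnit_one_add
    simpa using this
  obtain ⟨W, hW⟩ := hVu.exists_right_inv
  set H : R[X] := ∑ i ∈ Finset.range (N + 1), X ^ i * Q ^ (N - i) with hH
  set Z : R[X] := ∑ i ∈ Finset.range (N + 1), X ^ i * C ζ ^ (N - i) with hZ
  have hHp : H * (X - Q) = X ^ (N + 1) := by
    rw [hH]; simpa [hN] using (Commute.all (X : R[X]) Q).geom_sum₂_mul (N + 1)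
  have hZp : Z * (X - C ζ) = X ^ (N + 1) := by
    have h := (Commute.all (X : R[X]) (C ζ)).geom_sum₂_mul (N + 1)
    rw [← C_pow, hζN, C_0, sub_zero] at h
    simpa only [Nat.add_sub_cancel] using h
  have hHV : H * V = Z := by
    apply (monic_X_sub_C ζ).isRegular.right
    show H * V * (X - C ζ) = Z * (X - C ζ)
    rw [hZp, ← hHp, hV]; ring
  -- the logarithmic derivative of `X - Q` computed from the factorization
  have hlog : H * (Q - X * derivative Q) =
      X * Z + X ^ (N + 1) * (X * W * derivative V - 1) := by
    have hQ : Q = X - (X - C ζ) * V := by rw [← hV]; ring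
    have hd : derivative Q = 1 - (V + (X - C ζ) * derivative V) := by
      rw [hQ]; simp
    have hHW : H = Z * W := by rw [← hHV]; linear_combination (-H) * hW
    rw [hd]
    have e1 : Q - X * (1 - (V + (X - C ζ) * derivative V)) =
        -(X - Q) + X * (V + (X - C ζ) * derivative V) := by ring
    rw [e1, mul_add, mul_neg, hHp, ← hZp]
    rw [hHW]
    linear_combination (X * Z) * hW
  have hco : (H * (Q - X * derivative Q)).coeff N = ζ := by
    rw [hlog, coeff_add, coeff_X_pow_mul', if_neg (by omega), add_zero]
    obtain ⟨M, rfl⟩ : ∃ M, N = M + 1 := ⟨N - 1, by omega⟩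
    rw [coeff_X_mul, hZ, finsetSum_coeff, Finset.sum_eq_single M]
    · simp
    · intro b hb hbM
      rw [← C_pow, coeff_mul_C, coeff_X_pow, if_neg (Ne.symm hbM), zero_mul]
    · simp
  have hterm : ∀ q ∈ Finset.Icc 1 N, (1 / (q : F)) • (Q ^ q).coeff (q - 1) =
      (Q ^ (q - 1) * (Q - X * derivative Q)).coeff (q - 1) := by
    intro q hq
    obtain ⟨m, rfl⟩ : ∃ m, q = m + 1 := ⟨q - 1, by have := (Finset.mem_Icc.1 hq).1; omega⟩
    have hm : ((m + 1 : ℕ) : F) ≠ 0 := Nat.cast_ne_zero.2 (by omega)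
    have hne : (((m + 1 : ℕ) : F)) • (Q ^ m * (Q - X * derivative Q)).coeff m =
        (Q ^ (m + 1)).coeff m := by
      have : ((m + 1 : ℕ) : R[X]) * (Q ^ m * (Q - X * derivative Q)) =
          ((m + 1 : ℕ) : R[X]) * Q ^ (m + 1) - X * derivative (Q ^ (m + 1)) := by
        rw [derivative_pow_succ]; simp only [C_add, C_1, map_natCast]; push_cast; ring
      have h2 := congrArg (fun p => coeff p m) this
      simp only [coeff_sub, coeff_natCast_mul] at h2
      rw [Nat.cast_smul_eq_nsmul, nsmul_eq_mul, h2]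
      have : (X * derivative (Q ^ (m + 1))).coeff m = (m : R) * (Q ^ (m + 1)).coeff m := by
        cases m with
        | zero => simp
        | succ m => rw [coeff_X_mul, coeff_derivative]; push_cast; ring
      rw [this]; push_cast; ring
    simp only [Nat.add_sub_cancel]
    rw [← hne, smul_smul, one_div, inv_mul_cancel₀ hm, one_smul]
  rw [Finset.sum_congr rfl hterm]
  have hlast : (Q ^ N * (Q - X * derivative Q)).coeff N = 0 := by
    have hm : ((N + 1 : ℕ) : F) ≠ 0 := Nat.cast_ne_zero.2 (by omega)
    have : ((N + 1 : ℕ) : R[X]) * (Q ^ N * (Q - X * derivative Q)) = 0 := by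
      have h3 : ((N + 1 : ℕ) : R[X]) * (Q ^ N * (Q - X * derivative Q)) =
          ((N + 1 : ℕ) : R[X]) * Q ^ (N + 1) - X * derivative (Q ^ (N + 1)) := by
        rw [derivative_pow_succ]; simp only [C_add, C_1, map_natCast]; push_cast; ring
      rw [h3, hN]; simp
    have h2 := congrArg (fun p => coeff p N) this
    simp only [coeff_natCast_mul, coeff_zero] at h2
    rw [← nsmul_eq_mul, ← Nat.cast_smul_eq_nsmul F] at h2
    have := congrArg (fun z => (((N + 1 : ℕ) : F))⁻¹ • z) h2
    simpa only [smul_smul, inv_mul_cancel₀ hm, one_smul, smul_zero] using this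
  conv_lhs => rw [← hco, hH, Finset.sum_mul, finsetSum_coeff, ← Finset.sum_range_reflect,
    Finset.sum_range_succ]
  have : ∀ j ∈ Finset.range (N + 1), (X ^ (N + 1 - 1 - j) * Q ^ (N - (N + 1 - 1 - j)) *
      (Q - X * derivative Q)).coeff N = (Q ^ j * (Q - X * derivative Q)).coeff j := by
    intro j hj
    have hj' := Finset.mem_range.1 hj
    rw [mul_assoc, coeff_X_pow_mul', if_pos (by omega)]
    congr 3 <;> omega
  rw [this N (by simp), hlast, add_zero]
  rw [Finset.sum_congr rfl fun j hj => this j (by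
    have := Finset.mem_range.1 hj; exact Finset.mem_range.2 (by omega))]
  rw [Finset.range_eq_Ico, Finset.sum_Ico_eq_sum_range, ← Finset.Ico_succ_right_eq_Icc,
    Finset.sum_Ico_eq_sum_range]
  simp

/-! ### The graded lexicographic order -/

section GrLex

variable {r : ℕ}

theorem grMin_mem {A : Set (Expo r)} (h : A.Nonempty) : grMin A ∈ A := by
  rw [grMin, dif_pos h]
  exact Function.argminOn_mem _ _ _

theorem grMin_le {A : Set (Expo r)} {a : Expo r} (h : a ∈ A) :
    toDegLex (grMin A) ≤ toDegLex a := by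
  rw [grMin, dif_pos ⟨a, h⟩]
  exact Function.argminOn_le (toDegLex : Expo r → DegLex (Expo r)) A h

theorem grMin_eq {A : Set (Expo r)} {a : Expo r} (ha : a ∈ A)
    (h : ∀ b ∈ A, toDegLex a ≤ toDegLex b) : grMin A = a :=
  toDegLex_injective (le_antisymm (grMin_le ha) (h _ (grMin_mem ⟨a, ha⟩)))

theorem lt_grSucc (hr : 1 ≤ r) (k : Expo r) : toDegLex k < toDegLex (grSucc k) := by
  refine grMin_mem (A := {m | toDegLex k < toDegLex m}) ⟨k + Finsupp.single ⟨0, hr⟩ 1, ?_⟩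
  rw [Set.mem_ofPred_eq, Finsupp.DegLex.lt_iff]
  left
  simp

theorem grSucc_le {k m : Expo r} (h : toDegLex k < toDegLex m) :
    toDegLex (grSucc k) ≤ toDegLex m :=
  grMin_le (A := {m | toDegLex k < toDegLex m}) h

theorem degree_le_of_grLex_le {a b : Expo r} (h : toDegLex a ≤ toDegLex b) :
    a.degree ≤ b.degree :=
  Finsupp.DegLex.monotone_degree h

theorem le_of_grLex_add {a b : Expo r} : toDegLex a ≤ toDegLex (a + b) := by
  rw [toDegLex_add]
  exact le_add_of_nonneg_right bot_le

theorem nsmul_grLex_le_nsmul {m n : ℕ} (h : m ≤ n) (s : Expo r) :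
    toDegLex (m • s) ≤ toDegLex (n • s) := by
  obtain ⟨e, rfl⟩ := Nat.exists_eq_add_of_le h
  rw [add_smul]
  exact le_of_grLex_add

theorem finite_grLex_le (a : Expo r) : {b : Expo r | toDegLex b ≤ toDegLex a}.Finite := by
  refine (Set.finite_Iic (Finsupp.equivFunOnFinite.symm fun _ => a.degree)).subset ?_
  intro b hb t
  have h1 := degree_le_of_grLex_le hb
  have h2 := Finsupp.le_degree t b
  simpa using h2.trans h1

/-- On exponents of bounded degree, the graded lexicographic order is induced by a linear form
with positive integral coefficients. -/
theorem exists_weight (r B : ℕ) : ∃ w : Fin r → ℕ, (∀ t, 0 < w t) ∧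
    ∀ a b : Expo r, a.degree ≤ B → toDegLex a < toDegLex b →
      ∑ t, w t * a t < ∑ t, w t * b t := by
  -- digits in base `B + 1` for the lexicographic part, plus a large multiple of the degree
  set ε : Fin r → ℕ := fun t => (B + 1) ^ (r - 1 - t.1) with hε
  set W : ℕ := (B + 1) ^ r * B + 1 with hW
  have hdeg : ∀ a : Expo r, a.degree = ∑ t, a t := fun a => Finsupp.degree_eq_sum a
  have hsplit : ∀ a : Expo r, ∑ t, (W + ε t) * a t = W * a.degree + ∑ t, ε t * a t := by
    intro a
    rw [hdeg, Finset.mul_sum, ← Finset.sum_add_distrib]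
    exact Finset.sum_congr rfl fun t _ => by ring
  refine ⟨fun t => W + ε t, fun t => by positivity, fun a b ha hab => ?_⟩
  simp only [hsplit]
  rw [Finsupp.DegLex.lt_iff] at hab
  simp only [ofDegLex_toDegLex] at hab
  rcases hab with h | ⟨h, hlex⟩
  · have h1 : ∑ t, ε t * a t ≤ (B + 1) ^ r * B := by
      calc ∑ t, ε t * a t ≤ ∑ t, (B + 1) ^ r * a t :=
            Finset.sum_le_sum fun t _ => Nat.mul_le_mul_right _
              (Nat.pow_le_pow_right (by omega) (by omega))
        _ = (B + 1) ^ r * a.degree := by rw [← Finset.mul_sum, hdeg]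
        _ ≤ _ := Nat.mul_le_mul_left _ ha
    have h2 : W * (a.degree + 1) ≤ W * b.degree := Nat.mul_le_mul_left _ h
    rw [mul_add, mul_one] at h2
    omega
  · rw [h]
    refine Nat.add_lt_add_left ?_ _
    obtain ⟨t, hlt, ht⟩ := hlex
    simp only [ofLex_toLex] at hlt ht
    have hpt : ∀ s, ε s * a s ≤ (if s = t then ε t * a t else 0) +
        (if s < t then ε s * b s else 0) + (if t < s then (B + 1) ^ (r - 1 - (t.1 + 1)) * a s
          else 0) := by
      intro s
      rcases lt_trichotomy s t with hs | hs | hs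
      · simp [hs, hs.ne, hlt s hs]
      · simp [hs]
      · simp only [hs, if_true]
        refine le_trans (Nat.mul_le_mul_right _ (Nat.pow_le_pow_right (by omega) ?_))
          (Nat.le_add_left _ _)
        have : t.1 < s.1 := hs
        omega
    have hpt' : ∀ s, (if s = t then ε t * b t else 0) + (if s < t then ε s * b s else 0) ≤
        ε s * b s := by
      intro s
      rcases lt_trichotomy s t with hs | hs | hs
      · simp [hs, hs.ne]
      · simp [hs]
      · simp [hs.not_gt, hs.ne']
    have hA := Finset.sum_le_sum fun s (_ : s ∈ Finset.univ) => hpt s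
    have hB := Finset.sum_le_sum fun s (_ : s ∈ Finset.univ) => hpt' s
    simp only [Finset.sum_add_distrib, Finset.sum_ite_eq', Finset.mem_univ, if_true] at hA hB
    have hC : ∑ s, (if t < s then (B + 1) ^ (r - 1 - (t.1 + 1)) * a s else 0) < ε t := by
      by_cases htl : t.1 + 1 < r
      · calc ∑ s, (if t < s then (B + 1) ^ (r - 1 - (t.1 + 1)) * a s else 0)
            ≤ ∑ s, (B + 1) ^ (r - 1 - (t.1 + 1)) * a s :=
              Finset.sum_le_sum fun s _ => by split_ifs <;> simp
          _ = (B + 1) ^ (r - 1 - (t.1 + 1)) * a.degree := by rw [← Finset.mul_sum, hdeg]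
          _ ≤ (B + 1) ^ (r - 1 - (t.1 + 1)) * B := Nat.mul_le_mul_left _ ha
          _ < (B + 1) ^ (r - 1 - (t.1 + 1)) * (B + 1) :=
              Nat.mul_lt_mul_of_pos_left (by omega) (by positivity)
          _ = ε t := by rw [hε, ← pow_succ]; congr 1; omega
      · rw [Finset.sum_eq_zero]
        · positivity
        · intro s _
          rw [if_neg]
          intro hs
          have : t.1 < s.1 := hs
          omega
    have hD : ε t * a t + ε t ≤ ε t * b t := by
      rw [← Nat.mul_succ]; exact Nat.mul_le_mul_left _ ht
    omega

end GrLex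

/-! ### Valuation bounds for power series -/

section Valuation

variable {r : ℕ} {K : Type*} [Field K]

/-- `ValGE a f` says that the graded lexicographic valuation of `f` is at least `a`: no exponent
below `a` occurs in `f`. -/
def ValGE (a : Expo r) (f : PS r K) : Prop :=
  ∀ e, toDegLex e < toDegLex a → MvPowerSeries.coeff e f = 0

theorem ValGE.mono {a b : Expo r} {f : PS r K} (h : ValGE a f)
    (hba : toDegLex b ≤ toDegLex a) : ValGE b f := fun e he => h e (he.trans_le hba)

theorem valGE_zero (f : PS r K) : ValGE 0 f := fun _ he =>
  absurd he (not_lt.2 (bot_le : (⊥ : DegLex (Expo r)) ≤ _))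

theorem ValGE.neg {a : Expo r} {f : PS r K} (hf : ValGE a f) : ValGE a (-f) := fun e he => by
  rw [map_neg, hf e he, neg_zero]

theorem ValGE.add {a : Expo r} {f g : PS r K} (hf : ValGE a f) (hg : ValGE a g) :
    ValGE a (f + g) := fun e he => by rw [map_add, hf e he, hg e he, add_zero]

theorem ValGE.sum {ι : Type*} {s : Finset ι} {a : Expo r} {f : ι → PS r K}
    (h : ∀ i ∈ s, ValGE a (f i)) : ValGE a (∑ i ∈ s, f i) := fun e he => by
  rw [map_sum]; exact Finset.sum_eq_zero fun i hi => h i hi e he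

theorem ValGE.mul {a b : Expo r} {f g : PS r K} (hf : ValGE a f) (hg : ValGE b g) :
    ValGE (a + b) (f * g) := by
  classical
  intro e he
  rw [MvPowerSeries.coeff_mul]
  refine Finset.sum_eq_zero fun x hx => ?_
  rw [Finset.HasAntidiagonal.mem_antidiagonal] at hx
  by_cases h1 : toDegLex x.1 < toDegLex a
  · rw [hf _ h1, zero_mul]
  by_cases h2 : toDegLex x.2 < toDegLex b
  · rw [hg _ h2, mul_zero]
  refine absurd he (not_lt.2 ?_)
  rw [← hx, toDegLex_add, toDegLex_add]
  exact add_le_add (not_lt.1 h1) (not_lt.1 h2)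

theorem ValGE.mul_right {a : Expo r} {f : PS r K} (hf : ValGE a f) (g : PS r K) :
    ValGE a (f * g) := by
  simpa using hf.mul (valGE_zero g)

theorem ValGE.pow {a : Expo r} {f : PS r K} (hf : ValGE a f) (n : ℕ) : ValGE (n • a) (f ^ n) := by
  induction n with
  | zero => rw [zero_smul]; exact valGE_zero _
  | succ n ih => rw [pow_succ, succ_nsmul]; exact ih.mul hf

theorem valGE_monomial (a : Expo r) (c : K) : ValGE a (MvPowerSeries.monomial a c) := by
  classical
  intro e he
  rw [MvPowerSeries.coeff_monomial, if_neg]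
  rintro rfl
  exact lt_irrefl _ he

theorem ValGE.of_monomial_mul {a s : Expo r} {f : PS r K}
    (h : ValGE (s + a) (MvPowerSeries.monomial s 1 * f)) : ValGE a f := by
  intro e he
  have := h (s + e) (by rw [toDegLex_add, toDegLex_add]; exact add_lt_add_right he _)
  rwa [MvPowerSeries.coeff_add_monomial_mul, one_mul] at this

theorem coeff_initialPart (y₀ : PS r K) (k n : Expo r) :
    MvPowerSeries.coeff n (initialPart y₀ k) =
      if toDegLex n ≤ toDegLex k then MvPowerSeries.coeff n y₀ else 0 := rfl

theorem valGE_sub_initialPart (y₀ : PS r K) (k : Expo r) :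
    ValGE (grSucc k) (y₀ - initialPart y₀ k) := by
  intro e he
  rw [map_sub, coeff_initialPart, if_pos, sub_self]
  by_contra h
  exact absurd (grSucc_le (not_le.1 h)) (not_le.2 he)

theorem initialPart_grSucc (hr : 1 ≤ r) (y₀ : PS r K) (k : Expo r) :
    initialPart y₀ (grSucc k) = initialPart y₀ k +
      MvPowerSeries.monomial (grSucc k) (MvPowerSeries.coeff (grSucc k) y₀) := by
  classical
  ext n
  rw [map_add, coeff_initialPart, coeff_initialPart, MvPowerSeries.coeff_monomial]
  rcases lt_trichotomy (toDegLex n) (toDegLex (grSucc k)) with h | h | h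
  · have h1 : toDegLex n ≤ toDegLex k := by
      by_contra h2
      exact absurd (grSucc_le (not_le.1 h2)) (not_le.2 h)
    rw [if_pos h.le, if_pos h1, if_neg, add_zero]
    rintro rfl
    exact lt_irrefl _ h
  · obtain rfl := toDegLex_injective h
    rw [if_pos le_rfl, if_neg (not_le.2 (lt_grSucc hr k)), if_pos rfl, zero_add]
  · rw [if_neg (not_le.2 h), if_neg (not_le.2 ((lt_grSucc hr k).trans h)), if_neg, add_zero]
    rintro rfl
    exact lt_irrefl _ h

end Valuation

/-! ### Taylor expansion of `P` at the initial parts of the root -/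

section Expansion

variable {r : ℕ} {K : Type*} [Field K]

open Polynomial

theorem coeff_comp_C_add_C_mul_X {R : Type*} [CommRing R] (P : R[X]) (z v : R) (m : ℕ) :
    (P.comp (C z + C v * X)).coeff m = v ^ m * (hasseDeriv m P).eval z := by
  have : P.comp (C z + C v * X) = (taylor z P).comp (C v * X) := by
    rw [taylor_apply, comp_assoc]; simp [add_comm]
  rw [this, comp_C_mul_X_coeff, taylor_coeff, mul_comm]

theorem eval_add_eq_sum_hasseDeriv {R : Type*} [CommRing R] (P : R[X]) (z h : R) :
    P.eval (z + h) = ∑ m ∈ Finset.range (P.natDegree + 1), (hasseDeriv m P).eval z * h ^ m := by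
  rw [add_comm, ← taylor_eval, eval_eq_sum_range, natDegree_taylor]
  simp only [taylor_coeff]

theorem derivative_eval_add_eq_sum_hasseDeriv {R : Type*} [CommRing R] (P : R[X]) (z h : R) :
    P.derivative.eval (z + h) = ∑ m ∈ Finset.range (P.natDegree + 1),
      (m + 1) • ((hasseDeriv (m + 1) P).eval z * h ^ m) := by
  have hd : taylor z P.derivative = derivative (taylor z P) := by
    simp [taylor_apply, derivative_comp]
  have hdeg : (derivative (taylor z P)).natDegree < P.natDegree + 1 :=
    lt_of_le_of_lt (natDegree_derivative_le _) (by rw [natDegree_taylor]; omega)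
  rw [add_comm, ← taylor_eval, hd, eval_eq_sum_range' hdeg]
  refine Finset.sum_congr rfl fun m _ => ?_
  rw [coeff_derivative, taylor_coeff, nsmul_eq_mul]
  push_cast; ring

theorem coeff_piCoeff (Q : (PS r K)[X]) (i : Expo r) (j : ℕ) :
    (piCoeff Q i).coeff j = MvPowerSeries.coeff i (Q.coeff j) := by
  rw [piCoeff, finsetSum_coeff]
  simp only [coeff_monomial]
  rw [Finset.sum_ite_eq']
  split_ifs with h
  · rfl
  · rw [notMem_support_iff.1 h, map_zero]

theorem piCoeff_comp_X_add_C (Q : (PS r K)[X]) (i : Expo r) (c : K) :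
    piCoeff (Q.comp (X + C (MvPowerSeries.C c))) i = (piCoeff Q i).comp (X + C c) := by
  have hadd : ∀ A B : (PS r K)[X], piCoeff (A + B) i = piCoeff A i + piCoeff B i := by
    intro A B; ext j; simp [coeff_piCoeff]
  have hmap : ∀ (a : PS r K) (q : K[X]), piCoeff (C a * q.map MvPowerSeries.C) i =
      C (MvPowerSeries.coeff i a) * q := by
    intro a q; ext j
    rw [coeff_piCoeff, coeff_C_mul, coeff_C_mul, coeff_map, MvPowerSeries.coeff_mul_C]
  induction Q using Polynomial.induction_on' with
  | add A B hA hB => rw [add_comp, hadd, hadd, hA, hB, add_comp]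
  | monomial n a =>
    have e1 : (monomial n a).comp (X + C (MvPowerSeries.C c)) =
        C a * ((X + C c) ^ n : K[X]).map MvPowerSeries.C := by simp
    have e2 : (monomial n a : (PS r K)[X]) = C a * (X ^ n : K[X]).map MvPowerSeries.C := by
      rw [← C_mul_X_pow_eq_monomial]; simp
    rw [e1, hmap, e2, hmap]
    simp

/-- The polynomial `P(u, z_{S(k)} + u^{S(k)} y) = P_k(u, y + c_{S(k)})`, whose vanishing at
`y = (y₀ - z_{S(k)}) / u^{S(k)}` is the equation to be solved. -/
noncomputable def centred (P : (PS r K)[X]) (y₀ : PS r K) (k : Expo r) : (PS r K)[X] :=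
  P.comp (C (initialPart y₀ (grSucc k)) + C (MvPowerSeries.monomial (grSucc k) (1 : K)) * X)

theorem shifted_comp (hr : 1 ≤ r) (P : (PS r K)[X]) (y₀ : PS r K) (k : Expo r) :
    (shifted P y₀ k).comp (X + C (MvPowerSeries.C (MvPowerSeries.coeff (grSucc k) y₀))) =
      centred P y₀ k := by
  have : MvPowerSeries.monomial (grSucc k) (MvPowerSeries.coeff (grSucc k) y₀) =
      MvPowerSeries.monomial (grSucc k) (1 : K) *
        MvPowerSeries.C (MvPowerSeries.coeff (grSucc k) y₀) := by
    ext n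
    rw [MvPowerSeries.coeff_mul_C]
    classical
    simp [MvPowerSeries.coeff_monomial]
  rw [shifted, centred, comp_assoc, initialPart_grSucc hr, this]
  congr 1
  simp
  ring

theorem monomial_one_pow (s : Expo r) (m : ℕ) :
    (MvPowerSeries.monomial s (1 : K)) ^ m = MvPowerSeries.monomial (m • s) 1 := by
  rw [MvPowerSeries.monomial_pow, one_pow]

theorem coeff_centred (P : (PS r K)[X]) (y₀ : PS r K) (k : Expo r) (m : ℕ) :
    (centred P y₀ k).coeff m = MvPowerSeries.monomial (m • grSucc k) 1 *
      (hasseDeriv m P).eval (initialPart y₀ (grSucc k)) := by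
  rw [centred, coeff_comp_C_add_C_mul_X, monomial_one_pow]

theorem coeff_shifted (P : (PS r K)[X]) (y₀ : PS r K) (k : Expo r) (m : ℕ) :
    (shifted P y₀ k).coeff m = MvPowerSeries.monomial (m • grSucc k) 1 *
      (hasseDeriv m P).eval (initialPart y₀ k) := by
  rw [shifted, coeff_comp_C_add_C_mul_X, monomial_one_pow]

/-- Translating `y` by a constant does not change the valuation. -/
theorem iota_eq_grMin_centred (hr : 1 ≤ r) (P : (PS r K)[X]) (y₀ : PS r K) (k : Expo r) :
    iota P y₀ k =
      grMin {n | ∃ m, MvPowerSeries.coeff n ((centred P y₀ k).coeff m) ≠ 0} := by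
  have key : ∀ (Q : (PS r K)[X]) (n : Expo r),
      (∃ m, MvPowerSeries.coeff n (Q.coeff m) ≠ 0) ↔ piCoeff Q n ≠ 0 := by
    intro Q n
    rw [Ne, Polynomial.ext_iff, not_forall]
    simp [coeff_piCoeff]
  rw [iota, val]
  congr 1
  ext n
  rw [Set.mem_ofPred_eq, Set.mem_ofPred_eq, key, key, ← shifted_comp hr, piCoeff_comp_X_add_C, Ne,
    Ne, comp_X_add_C_eq_zero_iff]

theorem omegaZero_eq (hr : 1 ≤ r) (P : (PS r K)[X]) (y₀ : PS r K) :
    omegaZero P y₀ = MvPowerSeries.coeff (iota P y₀ (kZero P y₀))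
      ((centred P y₀ (kZero P y₀)).coeff 1) := by
  rw [← coeff_piCoeff, ← shifted_comp hr, piCoeff_comp_X_add_C, ← taylor_apply, taylor_coeff_one,
    omegaZero]

theorem valGE_iota_centred (hr : 1 ≤ r) (P : (PS r K)[X]) (y₀ : PS r K) (k : Expo r) (m : ℕ) :
    ValGE (iota P y₀ k) ((centred P y₀ k).coeff m) := by
  intro e he
  by_contra h
  rw [iota_eq_grMin_centred hr] at he
  exact absurd (grMin_le (A := {n | ∃ m, MvPowerSeries.coeff n ((centred P y₀ k).coeff m) ≠ 0})
    ⟨m, h⟩) (not_le.2 he)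

theorem exists_coeff_iota_shifted_ne_zero {P : (PS r K)[X]} (hP : P ≠ 0) (y₀ : PS r K)
    (k : Expo r) : ∃ m, MvPowerSeries.coeff (iota P y₀ k) ((shifted P y₀ k).coeff m) ≠ 0 := by
  refine grMin_mem (A := {n | ∃ m, MvPowerSeries.coeff n ((shifted P y₀ k).coeff m) ≠ 0}) ?_
  by_contra hemp
  rw [Set.not_nonempty_iff_eq_empty] at hemp
  have hall : ∀ n m, MvPowerSeries.coeff n ((shifted P y₀ k).coeff m) = 0 := by
    intro n m
    by_contra h
    exact (Set.eq_empty_iff_forall_notMem.1 hemp n) ⟨m, h⟩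
  apply hP
  rw [← taylor_eq_zero (initialPart y₀ k)]
  ext m n
  have := hall (m • grSucc k + n) m
  rw [coeff_shifted, MvPowerSeries.coeff_add_monomial_mul, one_mul] at this
  rw [taylor_coeff, this]
  simp

/-- Once `S(k)` exceeds the valuation `δ` of `P'(y₀)`, the polynomial `P_k(u, y + c_{S(k)})` starts
with `ω y u^{δ + S(k)}`, where `ω u^δ` is the first term of `P'(y₀)`. -/
theorem centred_leading (hr : 1 ≤ r) {P : (PS r K)[X]} {y₀ : PS r K} (hy₀ : P.eval y₀ = 0)
    {δ k : Expo r} (hδ : ValGE δ (P.derivative.eval y₀))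
    (hlt : toDegLex δ < toDegLex (grSucc k)) (m : ℕ) :
    ValGE (δ + grSucc k) ((centred P y₀ k).coeff m) ∧
    MvPowerSeries.coeff (δ + grSucc k) ((centred P y₀ k).coeff m) =
      if m = 1 then MvPowerSeries.coeff δ (P.derivative.eval y₀) else 0 := by
  set S := grSucc k with hS
  set S2 := grSucc S with hS2
  have hSS : toDegLex S < toDegLex S2 := lt_grSucc hr S
  set z := initialPart y₀ S with hz
  have hh : ValGE S2 (z - y₀) := by
    rw [← neg_sub]; exact (valGE_sub_initialPart y₀ S).neg
  have strict : ∀ {b : Expo r} {f : PS r K}, ValGE b f → toDegLex (δ + S) < toDegLex b →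
      ValGE (δ + S) f ∧ MvPowerSeries.coeff (δ + S) f = 0 := fun hf hb =>
    ⟨hf.mono hb.le, hf _ hb⟩
  rw [coeff_centred]
  obtain rfl | rfl | hm : m = 0 ∨ m = 1 ∨ 2 ≤ m := by omega
  · have : ValGE (δ + S2) (P.eval z) := by
      rw [← add_sub_cancel y₀ z, eval_add_eq_sum_hasseDeriv]
      refine ValGE.sum fun j _ => ?_
      obtain rfl | rfl | hj : j = 0 ∨ j = 1 ∨ 2 ≤ j := by omega
      · intro e _; simp [hy₀]
      · rw [hasseDeriv_one, pow_one]; exact hδ.mul hh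
      · rw [← zero_add (δ + S2)]
        refine (valGE_zero _).mul ((hh.pow j).mono ?_)
        refine le_trans ?_ (nsmul_grLex_le_nsmul hj S2)
        rw [two_smul, toDegLex_add, toDegLex_add]
        exact add_le_add_left (hlt.trans hSS).le _
    simpa using strict this (by rw [toDegLex_add, toDegLex_add]; exact add_lt_add_right hSS _)
  · obtain ⟨g, hg⟩ := sub_dvd_eval_sub z y₀ P.derivative
    have h1 : ValGE S2 (P.derivative.eval z - P.derivative.eval y₀) := by
      rw [hg]; exact hh.mul_right g
    have hq : P.derivative.eval z = P.derivative.eval y₀ +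
        (P.derivative.eval z - P.derivative.eval y₀) := by ring
    have hδ2 := hlt.trans hSS
    rw [hasseDeriv_one, one_smul, if_pos rfl, add_comm δ S]
    constructor
    · refine (valGE_monomial _ _).mul ?_
      rw [hq]; exact hδ.add (h1.mono hδ2.le)
    · rw [MvPowerSeries.coeff_add_monomial_mul, one_mul, hq, map_add, h1 _ hδ2, add_zero]
  · rw [if_neg (by omega)]
    refine strict (b := m • S) ?_ ?_
    · exact (valGE_monomial _ _).mul_right _
    · refine lt_of_lt_of_le ?_ (nsmul_grLex_le_nsmul hm S)
      rw [two_smul, toDegLex_add, toDegLex_add]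
      exact add_lt_add_left hlt _

theorem iota_eq_add (hr : 1 ≤ r) {P : (PS r K)[X]} {y₀ : PS r K} (hy₀ : P.eval y₀ = 0)
    {δ k : Expo r} (hδ : ValGE δ (P.derivative.eval y₀))
    (hω : MvPowerSeries.coeff δ (P.derivative.eval y₀) ≠ 0)
    (hlt : toDegLex δ < toDegLex (grSucc k)) : iota P y₀ k = δ + grSucc k := by
  rw [iota_eq_grMin_centred hr]
  refine grMin_eq ⟨1, ?_⟩ ?_
  · rw [(centred_leading hr hy₀ hδ hlt 1).2, if_pos rfl]; exact hω
  · rintro b ⟨m, hm⟩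
    by_contra h
    exact hm ((centred_leading hr hy₀ hδ hlt m).1 _ (not_le.1 h))

theorem coeff_eq_zero_of_valGE_monomial_mul {b s e : Expo r} {f : PS r K}
    (h : ValGE b (MvPowerSeries.monomial s 1 * f)) (he : toDegLex (s + e) < toDegLex b) :
    MvPowerSeries.coeff e f = 0 := by
  have := h _ he
  rwa [MvPowerSeries.coeff_add_monomial_mul, one_mul] at this

/-- If `i_{S(k)} = i_k - S(k) + S(S(k))`, then the coefficient `ω` of `u^{i_k} y` in
`P_k(u, y + c_{S(k)})` is nonzero, and `ω u^{i_k - S(k)}` is the first term of `P'(y₀)`. -/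
theorem leading_of_iota_grSucc (hr : 1 ≤ r) {P : (PS r K)[X]} (hP : P ≠ 0) {y₀ : PS r K}
    (hy₀ : P.eval y₀ = 0) {k : Expo r}
    (hk : iota P y₀ (grSucc k) + grSucc k = iota P y₀ k + grSucc (grSucc k)) :
    MvPowerSeries.coeff (iota P y₀ k) ((centred P y₀ k).coeff 1) ≠ 0 ∧
    ∃ δ, ValGE δ (P.derivative.eval y₀) ∧ MvPowerSeries.coeff δ (P.derivative.eval y₀) =
      MvPowerSeries.coeff (iota P y₀ k) ((centred P y₀ k).coeff 1) := by
  have hval := valGE_iota_centred hr P y₀ k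
  obtain ⟨m₀, hm₀⟩ := exists_coeff_iota_shifted_ne_zero hP y₀ (grSucc k)
  simp only [coeff_centred] at hval ⊢
  rw [coeff_shifted] at hm₀
  set i := iota P y₀ k
  set i' := iota P y₀ (grSucc k)
  set S := grSucc k
  set S2 := grSucc S
  set z := initialPart y₀ S
  set q : ℕ → PS r K := fun m => (hasseDeriv m P).eval z with hq
  have hSS : toDegLex S < toDegLex S2 := lt_grSucc hr S
  have hh : ValGE S2 (y₀ - z) := valGE_sub_initialPart y₀ S
  have hmul : ∀ (a b : Expo r) (f : PS r K), MvPowerSeries.monomial a 1 *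
      (MvPowerSeries.monomial b 1 * f) = MvPowerSeries.monomial (a + b) (1 : K) * f := by
    intro a b f
    rw [← mul_assoc, MvPowerSeries.monomial_mul_monomial, one_mul]
  have hnsmul : ∀ n : ℕ, toDegLex ((n + 1) • S) < toDegLex ((n + 1) • S2) := by
    intro n
    have : ∀ s : Expo r, toDegLex ((n + 1) • s) = (n + 1) • toDegLex s := fun s => rfl
    rw [this, this]
    exact nsmul_lt_nsmul_right (by omega) hSS
  have hlead : MvPowerSeries.coeff i (MvPowerSeries.monomial (1 • S) 1 * q 1) ≠ 0 := by
    intro h0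
    -- all the terms of positive degree in `y` of `P_{S(k)}` have valuation larger than `i'`
    have hstrict : ∀ m, 1 ≤ m → ∀ e, toDegLex e ≤ toDegLex i' →
        MvPowerSeries.coeff e (MvPowerSeries.monomial (m • S2) 1 * q m) = 0 := by
      intro m hm e he
      obtain rfl | ⟨n, rfl⟩ : m = 1 ∨ ∃ n, m = n + 1 + 1 := by
        rcases Nat.lt_or_ge 1 m with h | h
        · exact Or.inr ⟨m - 2, by omega⟩
        · exact Or.inl (by omega)
      · have h1 : ValGE (grSucc i) (MvPowerSeries.monomial (1 • S) 1 * q 1) := by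
          intro e he
          rcases lt_or_eq_of_le (a := toDegLex e) (b := toDegLex i)
            (by by_contra h; exact absurd (grSucc_le (not_le.1 h)) (not_le.2 he)) with h | h
          · exact hval 1 e h
          · rw [toDegLex_injective h]; exact h0
        have h2 := (valGE_monomial S2 (1 : K)).mul h1
        rw [hmul] at h2
        rw [one_smul] at h2 ⊢
        refine coeff_eq_zero_of_valGE_monomial_mul (s := S) (b := S2 + grSucc i) ?_ ?_
        · rwa [hmul, add_comm S]
        · calc toDegLex (S + e) ≤ toDegLex (i' + S) := by
                rw [add_comm S, toDegLex_add, toDegLex_add]; exact add_le_add_left he _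
            _ = toDegLex (S2 + i) := by rw [hk, add_comm]
            _ < _ := by
                rw [toDegLex_add, toDegLex_add]
                exact add_lt_add_right (lt_grSucc hr i) _
      · have h2 := (valGE_monomial ((n + 1 + 1) • S2) (1 : K)).mul (hval (n + 1 + 1))
        rw [hmul] at h2
        refine coeff_eq_zero_of_valGE_monomial_mul (s := (n + 1 + 1) • S)
          (b := (n + 1 + 1) • S2 + i) ?_ ?_
        · rwa [hmul, add_comm _ ((n + 1 + 1) • S2)]
        · calc toDegLex ((n + 1 + 1) • S + e) ≤ toDegLex ((n + 1 + 1) • S + i') := by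
                rw [toDegLex_add, toDegLex_add]; exact add_le_add_right he _
            _ = toDegLex ((n + 1) • S + (i + S2)) := by
                rw [← hk, succ_nsmul _ (n + 1)]; congr 1; abel
            _ < toDegLex ((n + 1) • S2 + (i + S2)) := by
                rw [toDegLex_add, toDegLex_add _ (i + S2)]
                exact add_lt_add_left (hnsmul n) _
            _ = _ := by rw [succ_nsmul _ (n + 1)]; congr 1; abel
    have hterm : ∀ m, 1 ≤ m → MvPowerSeries.coeff i' (q m * (y₀ - z) ^ m) = 0 := by
      intro m hm
      have h1 : ValGE (grSucc i') (MvPowerSeries.monomial (m • S2) 1 * q m) := by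
        intro e he
        refine hstrict m hm e ?_
        by_contra h; exact absurd (grSucc_le (not_le.1 h)) (not_le.2 he)
      have h2 := h1.mul (hh.pow m)
      rw [mul_assoc, add_comm] at h2
      exact h2.of_monomial_mul _ (lt_grSucc hr i')
    have hsum := eval_add_eq_sum_hasseDeriv P z (y₀ - z)
    rw [add_sub_cancel, hy₀, Finset.sum_range_succ'] at hsum
    have hq0 : MvPowerSeries.coeff i' (q 0) = 0 := by
      have h3 := congrArg (MvPowerSeries.coeff i') hsum
      rw [map_zero, map_add, map_sum, Finset.sum_eq_zero fun m _ => hterm (m + 1) (by omega),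
        zero_add, pow_zero, mul_one] at h3
      exact h3.symm
    rcases Nat.eq_zero_or_pos m₀ with rfl | hpos
    · apply hm₀
      rw [zero_smul, MvPowerSeries.monomial_zero_eq_C_apply, map_one, one_mul]
      exact hq0
    · exact hm₀ (hstrict m₀ hpos i' le_rfl)
  refine ⟨hlead, ?_⟩
  have hD : ∀ e, toDegLex e ≤ toDegLex i →
      MvPowerSeries.coeff e (MvPowerSeries.monomial S 1 * P.derivative.eval y₀) =
        MvPowerSeries.coeff e (MvPowerSeries.monomial (1 • S) 1 * q 1) := by
    intro e he
    have hsum := derivative_eval_add_eq_sum_hasseDeriv P z (y₀ - z)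
    rw [add_sub_cancel, Finset.sum_range_succ'] at hsum
    rw [hsum, mul_add, map_add, Finset.mul_sum, map_sum, Finset.sum_eq_zero]
    · simp [hq]
    · intro m _
      rw [mul_smul_comm, map_nsmul]
      refine smul_eq_zero_of_right _ ?_
      refine coeff_eq_zero_of_valGE_monomial_mul (s := (m + 1) • S) (b := i + (m + 1) • S2) ?_ ?_
      · rw [hmul, ← succ_nsmul, ← mul_assoc]
        exact (hval (m + 1 + 1)).mul (hh.pow (m + 1))
      · rw [add_comm i, toDegLex_add, toDegLex_add]
        exact add_lt_add_of_lt_of_le (hnsmul m) he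
  have hle : S ≤ i := by
    classical
    by_contra h
    rw [one_smul, MvPowerSeries.coeff_monomial_mul, if_neg h] at hlead
    exact hlead rfl
  obtain ⟨δ, hδ⟩ := exists_add_of_le hle
  refine ⟨δ, ValGE.of_monomial_mul (s := S) ?_, ?_⟩
  · intro e he
    rw [← hδ] at he
    rw [hD e he.le]
    exact hval 1 e he
  · rw [← hD i le_rfl, hδ, MvPowerSeries.coeff_add_monomial_mul, one_mul]

/-- `P'(y₀)` divides the discriminant, which lies in the ideal generated by `P` and `P'`. -/
theorem exists_mul_derivative_eval_eq_discrim [CharZero K] {P : (PS r K)[X]} (hP : P ≠ 0)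
    {y₀ : PS r K} (hy₀ : P.eval y₀ = 0) : ∃ V, P.derivative.eval y₀ * V = discrim P := by
  have hdeg : P.natDegree ≠ 0 := by
    intro h
    rw [eq_C_of_natDegree_eq_zero h, eval_C] at hy₀
    exact hP (by rw [eq_C_of_natDegree_eq_zero h, hy₀, C_0])
  obtain ⟨p, q, -, -, h⟩ := exists_mul_add_mul_eq_C_resultant P P.derivative le_rfl le_rfl
    (Or.inl hdeg)
  refine ⟨q.eval y₀, ?_⟩
  have := congrArg (eval y₀) h
  rw [eval_add, eval_mul, eval_mul, hy₀, zero_mul, zero_add, eval_C] at this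
  exact this

theorem exists_leading_of_order_lt {f g Δ : PS r K} (h : f * g = Δ) {n : ℕ}
    (hn : Δ.order + 1 ≤ (n : ℕ∞)) :
    ∃ δ, ValGE δ f ∧ MvPowerSeries.coeff δ f ≠ 0 ∧ δ.degree < n := by
  have hf1 : f.order + 1 ≤ n := by
    refine le_trans (add_le_add_left ?_ 1) hn
    rw [← h]
    exact le_self_add.trans MvPowerSeries.le_order_mul
  have hf0 : f ≠ 0 := by
    rintro rfl
    rw [MvPowerSeries.order_zero, top_add, top_le_iff] at hf1
    exact ENat.natCast_ne_top n hf1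
  obtain ⟨d, hd, hd'⟩ :=
    MvPowerSeries.exists_coeff_ne_zero_and_order (MvPowerSeries.ne_zero_iff_order_finite.1 hf0)
  refine ⟨grMin {e | MvPowerSeries.coeff e f ≠ 0}, ?_,
    grMin_mem (A := {e | MvPowerSeries.coeff e f ≠ 0}) ⟨d, hd⟩, ?_⟩
  · intro e he
    by_contra h'
    exact absurd (grMin_le (A := {e | MvPowerSeries.coeff e f ≠ 0}) h') (not_le.2 he)
  · have h1 := degree_le_of_grLex_le (grMin_le (A := {e | MvPowerSeries.coeff e f ≠ 0}) hd)
    rw [← hd'] at hf1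
    have h2 : d.degree + 1 ≤ n := by exact_mod_cast hf1
    omega

theorem eq_of_valGE_of_coeff_ne_zero {a b : Expo r} {f : PS r K} (ha : ValGE a f) (hb : ValGE b f)
    (ha' : MvPowerSeries.coeff a f ≠ 0) (hb' : MvPowerSeries.coeff b f ≠ 0) : a = b := by
  refine toDegLex_injective (le_antisymm ?_ ?_)
  · by_contra h; exact hb' (ha _ (not_le.1 h))
  · by_contra h; exact ha' (hb _ (not_le.1 h))

/-- The multi-index `k₀` exists, `ω₀` is the coefficient of the first term of `P'(y₀)`, and this
first term governs `P_k` as soon as `|k| > ord Δ_P`. -/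
theorem kZero_spec [CharZero K] (hr : 1 ≤ r) {P : (PS r K)[X]} (hP : P ≠ 0) {y₀ : PS r K}
    (hy₀ : P.eval y₀ = 0) {k : Expo r} (hk : (discrim P).order + 1 ≤ (k.degree : ℕ∞)) :
    iota P y₀ (grSucc (kZero P y₀)) + grSucc (kZero P y₀) =
      iota P y₀ (kZero P y₀) + grSucc (grSucc (kZero P y₀)) ∧
    omegaZero P y₀ ≠ 0 ∧
    ∀ m, ValGE (iota P y₀ k) ((centred P y₀ k).coeff m) ∧
      MvPowerSeries.coeff (iota P y₀ k) ((centred P y₀ k).coeff m) =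
        if m = 1 then omegaZero P y₀ else 0 := by
  obtain ⟨V, hV⟩ := exists_mul_derivative_eval_eq_discrim hP hy₀
  obtain ⟨δ, hδ, hω, hdeg⟩ := exists_leading_of_order_lt hV hk
  have hδk : toDegLex δ < toDegLex (grSucc k) := by
    refine lt_trans ?_ (lt_grSucc hr k)
    rw [Finsupp.DegLex.lt_iff]; exact Or.inl hdeg
  have hmem : k ∈ {k | iota P y₀ (grSucc k) + grSucc k = iota P y₀ k + grSucc (grSucc k)} := by
    rw [Set.mem_ofPred_eq, iota_eq_add hr hy₀ hδ hω hδk,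
      iota_eq_add hr hy₀ hδ hω (hδk.trans (lt_grSucc hr _))]
    abel
  have h0 : iota P y₀ (grSucc (kZero P y₀)) + grSucc (kZero P y₀) =
      iota P y₀ (kZero P y₀) + grSucc (grSucc (kZero P y₀)) := grMin_mem ⟨k, hmem⟩
  obtain ⟨hne, δ', hδ', hω'⟩ := leading_of_iota_grSucc hr hP hy₀ h0
  rw [← omegaZero_eq hr] at hne hω'
  obtain rfl : δ = δ' := eq_of_valGE_of_coeff_ne_zero hδ hδ' hω (hω' ▸ hne)
  refine ⟨h0, hne, fun m => ?_⟩
  rw [iota_eq_add hr hy₀ hδ hω hδk, ← hω']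
  exact centred_leading hr hy₀ hδ hδk m

end Expansion

/-! ### Lagrange inversion for Hahn series -/

section Hahn

open Polynomial

variable {Γ : Type*} [AddCommGroup Γ] [PartialOrder Γ] {K : Type*} [Field K]

/-- All the exponents of the Hahn series `f` have `φ`-weight at least `a`. -/
def WeightGE (φ : Γ →+ ℤ) (a : ℤ) (f : HahnSeries Γ K) : Prop :=
  ∀ l, f.coeff l ≠ 0 → a ≤ φ l

variable {φ : Γ →+ ℤ}

theorem WeightGE.zero (a : ℤ) : WeightGE φ a (0 : HahnSeries Γ K) := fun l hl => by simp at hl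

theorem WeightGE.mono {a b : ℤ} {f : HahnSeries Γ K} (h : WeightGE φ a f) (hb : b ≤ a) :
    WeightGE φ b f := fun l hl => hb.trans (h l hl)

theorem WeightGE.add {a : ℤ} {f g : HahnSeries Γ K} (hf : WeightGE φ a f)
    (hg : WeightGE φ a g) : WeightGE φ a (f + g) := by
  intro l hl
  by_cases h : f.coeff l = 0
  · refine hg l fun h' => hl ?_
    rw [HahnSeries.coeff_add, h, h', add_zero]
  · exact hf l h

theorem WeightGE.sum {ι : Type*} {s : Finset ι} {a : ℤ} {f : ι → HahnSeries Γ K}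
    (h : ∀ i ∈ s, WeightGE φ a (f i)) : WeightGE φ a (∑ i ∈ s, f i) := by
  classical
  induction s using Finset.induction_on with
  | empty => exact WeightGE.zero a
  | insert i s hi ih =>
    rw [Finset.sum_insert hi]
    exact (h i (Finset.mem_insert_self i s)).add
      (ih fun j hj => h j (Finset.mem_insert_of_mem hj))

variable [IsOrderedCancelAddMonoid Γ]

theorem exists_coeff_ne_zero_of_coeff_mul {f g : HahnSeries Γ K} {l : Γ}
    (h : (f * g).coeff l ≠ 0) : ∃ l₁ l₂, f.coeff l₁ ≠ 0 ∧ g.coeff l₂ ≠ 0 ∧ l₁ + l₂ = l := by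
  rw [HahnSeries.coeff_mul] at h
  obtain ⟨x, hx, -⟩ := Finset.exists_ne_zero_of_sum_ne_zero h
  rw [Finset.mem_antidiagonal] at hx
  exact ⟨x.1, x.2, hx.1, hx.2.1, hx.2.2⟩

theorem WeightGE.mul {a b : ℤ} {f g : HahnSeries Γ K} (hf : WeightGE φ a f)
    (hg : WeightGE φ b g) : WeightGE φ (a + b) (f * g) := by
  intro l hl
  obtain ⟨l₁, l₂, h₁, h₂, rfl⟩ := exists_coeff_ne_zero_of_coeff_mul hl
  rw [map_add]
  exact add_le_add (hf _ h₁) (hg _ h₂)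

theorem weightGE_algebraMap (c : K) : WeightGE φ 0 (algebraMap K (HahnSeries Γ K) c) := by
  classical
  intro l hl
  rw [HahnSeries.algebraMap_apply, HahnSeries.C_apply, HahnSeries.coeff_single] at hl
  have : l = 0 := by
    by_contra h
    exact hl (if_neg h)
  rw [this, map_zero]

theorem weightGE_coeff_mul {a b : ℤ} {A B : (HahnSeries Γ K)[X]}
    (hA : ∀ m, WeightGE φ a (A.coeff m)) (hB : ∀ m, WeightGE φ b (B.coeff m)) (m : ℕ) :
    WeightGE φ (a + b) ((A * B).coeff m) := by
  rw [coeff_mul]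
  exact WeightGE.sum fun x _ => (hA _).mul (hB _)

theorem weightGE_coeff_one (m : ℕ) : WeightGE φ 0 ((1 : (HahnSeries Γ K)[X]).coeff m) := by
  rw [coeff_one]
  split_ifs
  · simpa using weightGE_algebraMap (φ := φ) (1 : K)
  · exact WeightGE.zero 0

theorem weightGE_coeff_pow {a : ℤ} {A : (HahnSeries Γ K)[X]}
    (hA : ∀ m, WeightGE φ a (A.coeff m)) (q m : ℕ) : WeightGE φ (q * a) ((A ^ q).coeff m) := by
  induction q generalizing m with
  | zero => simpa using weightGE_coeff_one m
  | succ q ih =>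
    rw [pow_succ, Nat.cast_succ, add_mul, one_mul]
    exact weightGE_coeff_mul ih hA m

variable (K) in
/-- The subalgebra of the Hahn series whose exponents have nonnegative weight. -/
def nonnegWeight (φ : Γ →+ ℤ) : Subalgebra K (HahnSeries Γ K) where
  carrier := {f | WeightGE φ 0 f}
  mul_mem' hf hg := by simpa using hf.mul hg
  add_mem' hf hg := hf.add hg
  algebraMap_mem' := weightGE_algebraMap

variable (K) in
/-- The ideal of `nonnegWeight K φ` of the series all of whose exponents have weight `> N`. -/
def largeWeight (φ : Γ →+ ℤ) (N : ℕ) : Ideal (nonnegWeight K φ) where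
  carrier := {f | WeightGE φ (N + 1) f.1}
  add_mem' hf hg := WeightGE.add hf hg
  zero_mem' := WeightGE.zero _
  smul_mem' c f hf := by
    have := WeightGE.mul c.2 hf
    rwa [zero_add] at this

/-- `eq_sum_coeff_pow_of_eval_eq` for the quotient of a subalgebra `A` by an ideal `J`, stated as a
congruence modulo `J`. -/
theorem exists_mem_eq_sub_sum_coeff_pow {F H : Type*} [Field F] [CharZero F] [CommRing H]
    [Algebra F H] (A : Subalgebra F H) (J : Ideal A) {Q : H[X]} {ζ : H}
    (hQ : ∀ m, Q.coeff m ∈ A) (hζ : ζ ∈ A) (h : Q.eval ζ = ζ) {N : ℕ}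
    (hN : ∀ m, ∃ f ∈ J, (f : H) = (Q ^ (N + 1)).coeff m) :
    ∃ f ∈ J, (f : H) = ζ - ∑ q ∈ Finset.Icc 1 N, (1 / (q : F)) • (Q ^ q).coeff (q - 1) := by
  obtain ⟨Q', rfl⟩ : Q ∈ lifts (A.val : A →+* H) := by
    rw [lifts_iff_coeff_lifts]
    exact fun m => ⟨⟨Q.coeff m, hQ m⟩, rfl⟩
  have hpow : ∀ q m, ((Q' ^ q).coeff m : H) =
      ((mapRingHom (A.val : A →+* H) Q') ^ q).coeff m := by
    intro q m
    rw [← map_pow, coe_mapRingHom, coeff_map]; rfl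
  obtain ⟨ζ', rfl⟩ : ∃ ζ' : A, (ζ' : H) = ζ := ⟨⟨ζ, hζ⟩, rfl⟩
  have hζ' : Q'.eval ζ' = ζ' := by
    apply Subtype.ext
    rw [coe_mapRingHom, eval_map] at h
    exact (eval₂_hom (A.val : A →+* H) (p := Q') ζ').symm.trans h
  have hev : (Q'.map (Ideal.Quotient.mk J)).eval (Ideal.Quotient.mk J ζ') =
      Ideal.Quotient.mk J ζ' := by
    rw [eval_map, eval₂_hom, hζ']
  have hnil : (Q'.map (Ideal.Quotient.mk J)) ^ (N + 1) = 0 := by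
    ext m
    rw [← Polynomial.map_pow, coeff_map, coeff_zero, Ideal.Quotient.eq_zero_iff_mem]
    obtain ⟨f, hf, hfe⟩ := hN m
    rw [← hpow] at hfe
    rwa [← Subtype.ext hfe]
  have hL := eq_sum_coeff_pow_of_eval_eq (F := F) hev hnil
  refine ⟨ζ' - ∑ q ∈ Finset.Icc 1 N, (1 / (q : F)) • (Q' ^ q).coeff (q - 1), ?_, ?_⟩
  · rw [← Ideal.Quotient.eq_zero_iff_mem, map_sub, sub_eq_zero]
    conv_lhs => rw [hL]
    rw [map_sum]
    refine Finset.sum_congr rfl fun q _ => ?_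
    rw [← Polynomial.map_pow, coeff_map]
    exact (map_smul (Ideal.Quotient.mkₐ F J) _ _).symm
  · rw [AddSubgroupClass.coe_sub, AddSubmonoidClass.coe_finsetSum]
    congr 1
    refine Finset.sum_congr rfl fun q _ => ?_
    rw [← hpow]; rfl

/-- Lagrange inversion for Hahn series: the root `ζ` of `y = Q(y)` is `∑ (1/q) [y^{q-1}] Q^q`, and
for a given exponent only finitely many terms contribute. -/
theorem coeff_eq_sum_coeff_pow [CharZero K] {Q : (HahnSeries Γ K)[X]} {ζ : HahnSeries Γ K}
    (hQ : ∀ m, WeightGE φ 1 (Q.coeff m)) (hζ : WeightGE φ 0 ζ) (h : Q.eval ζ = ζ)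
    {n : Γ} {N : ℕ} (hn : φ n ≤ N) :
    ζ.coeff n = ∑ q ∈ Finset.Icc 1 N, (1 / (q : K)) * ((Q ^ q).coeff (q - 1)).coeff n := by
  obtain ⟨f, hf, hfe⟩ := exists_mem_eq_sub_sum_coeff_pow (nonnegWeight K φ) (largeWeight K φ N)
    (fun m => (hQ m).mono (by norm_num)) hζ h (N := N) (fun m => by
      have h1 := weightGE_coeff_pow hQ (N + 1) m
      rw [mul_one] at h1
      push_cast at h1
      exact ⟨⟨_, h1.mono (by positivity)⟩, h1, rfl⟩)
  have h0 : f.1.coeff n = 0 := by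
    by_contra hne
    have := hf n hne
    omega
  rw [hfe, HahnSeries.coeff_sub, sub_eq_zero] at h0
  rw [h0, HahnSeries.coeff_sum]
  simp

/-- If `u^n y^j` occurs in `Q^q`, it is a product of `q` monomials of `Q`. -/
theorem exists_tuple_of_coeff_pow_ne_zero {Q : (HahnSeries Γ K)[X]} {q j : ℕ} {n : Γ}
    (h : ((Q ^ q).coeff j).coeff n ≠ 0) :
    ∃ M : (Γ × ℕ) →₀ ℕ, (∀ x ∈ M.support, (Q.coeff x.2).coeff x.1 ≠ 0) ∧
      M.degree = q ∧ yWeight M = j ∧ gPair M = n := by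
  classical
  induction q generalizing j n with
  | zero =>
    rw [pow_zero, coeff_one] at h
    have hj : j = 0 := by
      by_contra hj
      rw [if_neg (by omega)] at h
      simp at h
    rw [if_pos hj, HahnSeries.coeff_one] at h
    have hn : n = 0 := by
      by_contra hn
      exact h (if_neg hn)
    exact ⟨0, by simp, by simp, by simp [yWeight, hj], by simp [gPair, hn]⟩
  | succ q ih =>
    rw [pow_succ, coeff_mul, HahnSeries.coeff_sum] at h
    obtain ⟨x, hx, hne⟩ := Finset.exists_ne_zero_of_sum_ne_zero h
    obtain ⟨l₁, l₂, h₁, h₂, rfl⟩ := exists_coeff_ne_zero_of_coeff_mul hne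
    obtain ⟨M, hM, hd, hy, hg⟩ := ih h₁
    refine ⟨M + Finsupp.single (l₂, x.2) 1, ?_, ?_, ?_, ?_⟩
    · intro y hy
      rcases Finset.mem_union.1 (Finsupp.support_add hy) with h | h
      · exact hM y h
      · have := Finsupp.support_single_subset h
        rw [Finset.mem_singleton] at this
        subst this
        exact h₂
    · rw [map_add, hd]; simp
    · rw [yWeight, Finsupp.sum_add_index' (by simp) (by intros; ring),
        Finsupp.sum_single_index (by simp), one_mul]
      rw [yWeight] at hy
      rw [hy]
      exact Finset.HasAntidiagonal.mem_antidiagonal.1 hx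
    · rw [gPair, Finsupp.sum_add_index' (by simp) (by intros; rw [add_smul]),
        Finsupp.sum_single_index (by simp), one_smul]
      rw [gPair] at hg
      rw [hg]

end Hahn

/-! ### The fixed-point equation with exponents in `ℤ^r` -/

section Embedding

open Polynomial

variable {r : ℕ} {K : Type*} [Field K]

/-- The inclusion `ℕ^r → ℤ^r`. -/
def toZHom (r : ℕ) : Expo r →+ (Fin r → ℤ) where
  toFun := toZ
  map_zero' := by ext; simp [toZ]
  map_add' a b := by ext; simp [toZ]

theorem toZ_add (a b : Expo r) : toZ (a + b) = toZ a + toZ b := map_add (toZHom r) a b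

theorem toZ_nsmul (m : ℕ) (a : Expo r) : toZ (m • a) = m • toZ a := map_nsmul (toZHom r) m a

theorem toZ_injective : Function.Injective (toZ : Expo r → Fin r → ℤ) := by
  intro a b h
  ext t
  have := congrFun h t
  simpa [toZ] using this

theorem toZ_le_iff (a b : Expo r) : toZ a ≤ toZ b ↔ a ≤ b := by
  constructor
  · intro h t
    have := h t
    simpa [toZ] using this
  · intro h t
    have := h t
    simpa [toZ] using this

variable (r K) in
/-- The embedding of `K[[u]]` into the ring of Hahn series with exponents in `ℤ^r` (for the product
order), where the monomials `u^n` are invertible. -/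
noncomputable def toHahn : PS r K →+* HahnSeries (Fin r → ℤ) K :=
  (HahnSeries.embDomainRingHom (toZHom r) toZ_injective toZ_le_iff).comp
    (HahnSeries.toMvPowerSeries.symm : PS r K ≃+* HahnSeries (Expo r) K).toRingHom

theorem coeff_toHahn (f : PS r K) (n : Expo r) :
    (toHahn r K f).coeff (toZ n) = MvPowerSeries.coeff n f := by
  rw [← HahnSeries.coeff_toMvPowerSeries_symm]
  exact HahnSeries.embDomain_coeff (f := ⟨⟨toZHom r, toZ_injective⟩, toZ_le_iff _ _⟩)

theorem exists_of_coeff_toHahn_ne_zero {f : PS r K} {l : Fin r → ℤ}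
    (h : (toHahn r K f).coeff l ≠ 0) : ∃ n, toZ n = l := by
  by_contra hl
  refine h (HahnSeries.embDomain_of_notMem_range
    (f := ⟨⟨toZHom r, toZ_injective⟩, toZ_le_iff _ _⟩) ?_)
  rintro ⟨n, hn⟩
  exact hl ⟨n, hn⟩

theorem toHahn_monomial (n : Expo r) :
    toHahn r K (MvPowerSeries.monomial n 1) = HahnSeries.single (toZ n) 1 := by
  classical
  ext l
  rw [HahnSeries.coeff_single]
  by_cases h : ∃ m, toZ m = l
  · obtain ⟨m, rfl⟩ := h
    rw [coeff_toHahn, MvPowerSeries.coeff_monomial]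
    simp only [toZ_injective.eq_iff]
  · rw [if_neg fun h' => h ⟨n, h'.symm⟩]
    by_contra h'
    exact h (exists_of_coeff_toHahn_ne_zero h')

/-- The series `Q_k(u, y) = y - P_k(u, y + c_{S(k)}) / (ω₀ u^{i_k})`. -/
noncomputable def fixedPointPoly (P : (PS r K)[X]) (y₀ : PS r K) (k : Expo r) :
    (HahnSeries (Fin r → ℤ) K)[X] :=
  X - C (HahnSeries.single (-toZ (iota P y₀ k)) (omegaZero P y₀)⁻¹) *
    (centred P y₀ k).map (toHahn r K)

/-- The remainder `(y₀ - z_{S(k)}) / u^{S(k)}`. -/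
noncomputable def remainderRoot (y₀ : PS r K) (k : Expo r) : HahnSeries (Fin r → ℤ) K :=
  HahnSeries.single (-toZ (grSucc k)) 1 * toHahn r K (y₀ - initialPart y₀ (grSucc k))

/-- The remainder of the root solves `y = Q_k(u, y)`, since `P(u, y₀) = 0`. -/
theorem eval_fixedPointPoly {P : (PS r K)[X]} {y₀ : PS r K} (hy₀ : P.eval y₀ = 0) (k : Expo r) :
    (fixedPointPoly P y₀ k).eval (remainderRoot y₀ k) = remainderRoot y₀ k := by
  have h : ((centred P y₀ k).map (toHahn r K)).eval (remainderRoot y₀ k) = 0 := by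
    rw [centred, Polynomial.map_comp, eval_comp]
    have : eval (remainderRoot y₀ k) ((C (initialPart y₀ (grSucc k)) +
        C (MvPowerSeries.monomial (grSucc k) (1 : K)) * X : (PS r K)[X]).map (toHahn r K)) =
        toHahn r K y₀ := by
      simp only [Polynomial.map_add, Polynomial.map_mul, map_C, map_X, eval_add, eval_mul, eval_C,
        eval_X, toHahn_monomial, remainderRoot]
      rw [← mul_assoc, HahnSeries.single_mul_single, add_neg_cancel, one_mul,
        HahnSeries.single_zero_one, one_mul, ← map_add, add_sub_cancel]
    rw [this, eval_map, eval₂_hom, hy₀, map_zero]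
  rw [fixedPointPoly, eval_sub, eval_mul, h, mul_zero, sub_zero, eval_X]

theorem coeff_fixedPointPoly (hr : 1 ≤ r) (P : (PS r K)[X]) (y₀ : PS r K) (k : Expo r)
    (l : Fin r → ℤ) (m : ℕ) :
    ((fixedPointPoly P y₀ k).coeff m).coeff l = coeffQ P y₀ k l m := by
  classical
  rw [fixedPointPoly, coeff_sub, coeff_C_mul, coeff_map, coeff_X, HahnSeries.coeff_sub,
    HahnSeries.coeff_single_mul, sub_neg_eq_add, coeffQ, coeffR, shifted_comp hr]
  have h1 : (if 1 = m then (1 : HahnSeries (Fin r → ℤ) K) else 0).coeff l =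
      if l = 0 ∧ m = 1 then 1 else 0 := by
    by_cases hm : 1 = m
    · rw [if_pos hm, HahnSeries.coeff_one]; simp [hm.symm]
    · rw [if_neg hm, if_neg fun h => hm h.2.symm, HahnSeries.coeff_zero]
  rw [h1]
  by_cases h : ∃ n : Expo r, toZ n = l + toZ (iota P y₀ k)
  · rw [dif_pos h, ← coeff_toHahn, h.choose_spec, div_neg, div_eq_mul_inv]; ring
  · rw [dif_neg h, by_contra fun hne => h (exists_of_coeff_toHahn_ne_zero hne)]; ring

theorem coeff_remainderRoot {y₀ : PS r K} {k p : Expo r} {l : Fin r → ℤ}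
    (hl : toZ p = l + toZ (grSucc k)) (hp : toDegLex (grSucc k) < toDegLex p) :
    (remainderRoot y₀ k).coeff l = MvPowerSeries.coeff p y₀ := by
  rw [remainderRoot, HahnSeries.coeff_single_mul, sub_neg_eq_add, ← hl, coeff_toHahn, one_mul,
    map_sub, coeff_initialPart, if_neg (not_le.2 hp), sub_zero]

theorem exists_of_coeff_remainderRoot_ne_zero {y₀ : PS r K} {k : Expo r} {l : Fin r → ℤ}
    (h : (remainderRoot y₀ k).coeff l ≠ 0) :
    ∃ p, toZ p = l + toZ (grSucc k) ∧ toDegLex (grSucc k) < toDegLex p := by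
  rw [remainderRoot, HahnSeries.coeff_single_mul, sub_neg_eq_add, one_mul] at h
  obtain ⟨p, hp⟩ := exists_of_coeff_toHahn_ne_zero h
  refine ⟨p, hp, ?_⟩
  by_contra hle
  rw [← hp, coeff_toHahn, map_sub, coeff_initialPart, if_pos (not_lt.1 hle), sub_self] at h
  exact h rfl

/-- All the exponents of `Q_k` are positive for the graded lexicographic order: the first term
`ω₀ y u^{i_k}` of `P_k(u, y + c_{S(k)})` is cancelled by `y`. -/
theorem exists_of_coeffQ_ne_zero (hr : 1 ≤ r) {P : (PS r K)[X]} {y₀ : PS r K} {k : Expo r}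
    (hω : omegaZero P y₀ ≠ 0)
    (hG : ∀ m, ValGE (iota P y₀ k) ((centred P y₀ k).coeff m) ∧
      MvPowerSeries.coeff (iota P y₀ k) ((centred P y₀ k).coeff m) =
        if m = 1 then omegaZero P y₀ else 0)
    {l : Fin r → ℤ} {m : ℕ} (h : coeffQ P y₀ k l m ≠ 0) :
    ∃ n, toZ n = l + toZ (iota P y₀ k) ∧ toDegLex (iota P y₀ k) < toDegLex n := by
  classical
  rw [coeffQ, coeffR, shifted_comp hr] at h
  by_cases hn : ∃ n : Expo r, toZ n = l + toZ (iota P y₀ k)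
  · rw [dif_pos hn] at h
    refine ⟨hn.choose, hn.choose_spec, ?_⟩
    by_contra hle
    rcases lt_or_eq_of_le (not_lt.1 hle) with hlt | heq
    · rw [(hG m).1 _ hlt, zero_div, zero_add, if_neg] at h
      · exact h rfl
      · rintro ⟨hl, -⟩
        have h1 := hn.choose_spec.trans (congrArg (· + toZ (iota P y₀ k)) hl)
        rw [zero_add] at h1
        rw [toZ_injective h1] at hlt
        exact lt_irrefl _ hlt
    · have heq' := toDegLex_injective heq
      have hl : l = 0 := by
        have h1 := hn.choose_spec
        rw [heq'] at h1
        simpa using h1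
      rw [heq', (hG m).2] at h
      by_cases hm : m = 1
      · apply h
        rw [if_pos hm, if_pos ⟨hl, hm⟩, div_neg, div_self hω, neg_add_cancel]
      · apply h
        rw [if_neg hm, if_neg fun h => hm h.2, zero_div, zero_add]
  · exfalso
    rw [dif_neg hn, zero_add] at h
    by_cases hl : l = 0 ∧ m = 1
    · exact hn ⟨iota P y₀ k, by rw [hl.1, zero_add]⟩
    · exact h (if_neg hl)

/-- The linear form on `ℤ^r` with the coefficients `w`. -/
def weightHom (w : Fin r → ℕ) : (Fin r → ℤ) →+ ℤ where
  toFun l := ∑ t, (w t : ℤ) * l t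
  map_zero' := by simp
  map_add' a b := by simp [mul_add, Finset.sum_add_distrib]

theorem weightHom_toZ (w : Fin r → ℕ) (n : Expo r) :
    weightHom w (toZ n) = ((∑ t, w t * n t : ℕ) : ℤ) := by
  simp [weightHom, toZ]

end Embedding

/-! ### Multinomial coefficients -/

section Multinomial

variable {α : Type*}

theorem mem_finsuppAntidiag_iff [DecidableEq α] {s : Finset α} {q : ℕ} {N : α →₀ ℕ} :
    N ∈ Finset.finsuppAntidiag s q ↔ N.degree = q ∧ N.support ⊆ s := by
  rw [Finset.mem_finsuppAntidiag']
  rfl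

theorem sum_pow_eq_sum_finsuppAntidiag [DecidableEq α] {R : Type*} [CommSemiring R]
    (s : Finset α) (f : α → R) (q : ℕ) :
    (∑ i ∈ s, f i) ^ q = ∑ N ∈ Finset.finsuppAntidiag s q,
      (N.multinomial : R) * N.prod fun i c => f i ^ c := by
  rw [Finset.sum_pow_eq_sum_piAntidiag]
  symm
  refine Finset.sum_bij (fun N _ => (N : α → ℕ)) ?_ ?_ ?_ ?_
  · intro N hN
    rw [Finset.mem_finsuppAntidiag] at hN
    rw [Finset.mem_piAntidiag]
    exact ⟨hN.1, fun i hi => hN.2 (Finsupp.mem_support_iff.2 hi)⟩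
  · intro N _ N' _ h
    exact DFunLike.coe_injective h
  · intro g hg
    rw [Finset.mem_piAntidiag] at hg
    refine ⟨Finsupp.onFinset s g hg.2, ?_, rfl⟩
    rw [Finset.mem_finsuppAntidiag]
    exact ⟨hg.1, Finsupp.support_onFinset_subset⟩
  · intro N hN
    have hN' := (Finset.mem_finsuppAntidiag.1 hN).2
    rw [Finsupp.multinomial_eq_of_support_subset hN',
      Finsupp.prod_of_support_subset N hN' _ (by simp)]

theorem factProd_mul_multinomial (N : α →₀ ℕ) :
    factProd N * N.multinomial = N.degree.factorial :=
  Nat.multinomial_spec N.support N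

theorem factProd_ne_zero (N : α →₀ ℕ) : factProd N ≠ 0 :=
  Finset.prod_ne_zero_iff.2 fun _ _ => Nat.factorial_ne_zero _

theorem factorial_div_factProd (N : α →₀ ℕ) :
    (N.degree.factorial : ℚ) / (factProd N : ℚ) = (N.multinomial : ℚ) := by
  rw [div_eq_iff (by exact_mod_cast factProd_ne_zero N), ← factProd_mul_multinomial]
  push_cast; ring

/-- The degree divides `N_x` times the multinomial coefficient of `N`. -/
theorem degree_dvd_mul_multinomial (N : α →₀ ℕ) (x : α) : N.degree ∣ N x * N.multinomial := by
  classical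
  rcases Nat.eq_zero_or_pos (N x) with h0 | hpos
  · simp [h0]
  set N' := N - Finsupp.single x 1 with hN'
  have hN : N = N' + Finsupp.single x 1 := by
    rw [hN', tsub_add_cancel_of_le]
    exact Finsupp.single_le_iff.2 hpos
  have hdeg : N.degree = N'.degree + 1 := by
    rw [hN, map_add, Finsupp.degree_single]
  have hfact : factProd N = N x * factProd N' := by
    have hs : N.support ⊆ insert x N'.support := by
      intro y hy
      by_cases hxy : y = x
      · simp [hxy]
      · refine Finset.mem_insert_of_mem (Finsupp.mem_support_iff.2 ?_)
        rw [hN', Finsupp.tsub_apply, Finsupp.single_apply, if_neg (Ne.symm hxy), tsub_zero]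
        exact Finsupp.mem_support_iff.1 hy
    have hx : x ∈ insert x N'.support := Finset.mem_insert_self _ _
    rw [factProd, factProd, Finsupp.prod_of_support_subset N hs _ (by simp),
      Finsupp.prod_of_support_subset N' (Finset.subset_insert x _) _ (by simp),
      ← Finset.mul_prod_erase _ _ hx, ← Finset.mul_prod_erase _ (fun y => (N' y).factorial) hx,
      ← mul_assoc]
    congr 1
    · rw [hN]
      simp [Nat.factorial_succ]
    · refine Finset.prod_congr rfl fun y hy => ?_
      rw [hN', Finsupp.tsub_apply, Finsupp.single_apply,
        if_neg (Ne.symm (Finset.ne_of_mem_erase hy)), tsub_zero]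
  refine ⟨N'.multinomial, ?_⟩
  have h1 := factProd_mul_multinomial N
  have h2 := factProd_mul_multinomial N'
  rw [hdeg, Nat.factorial_succ, ← h2, hfact] at h1
  rw [hdeg]
  refine Nat.eq_of_mul_eq_mul_left (Nat.pos_of_ne_zero (factProd_ne_zero N')) ?_
  linarith

/-- If a tuple `N` of degree `q` has weight `q - 1` for some weights `m`, then `q` divides its
multinomial coefficient, because `q` divides `q` times it and `q - 1` times it. -/
theorem dvd_multinomial_of_weight {N : α →₀ ℕ} (m : α → ℕ)
    (h : (N.sum fun x c => c * m x) + 1 = N.degree) : N.degree ∣ N.multinomial := by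
  have h1 : N.degree ∣ (N.sum fun x c => c * m x) * N.multinomial := by
    rw [Finsupp.sum, Finset.sum_mul]
    refine Finset.dvd_sum fun x _ => ?_
    rw [mul_right_comm]
    exact (degree_dvd_mul_multinomial N x).mul_right _
  have h2 : N.degree ∣ (N.sum fun x c => c * m x) * N.multinomial + N.multinomial :=
    ⟨N.multinomial, by rw [← h]; ring⟩
  exact (Nat.dvd_add_right h1).1 h2

end Multinomial

/-! ### The admissible indices -/

section Indices

variable {r : ℕ} {K : Type*} [Field K]

theorem mBound_spec {d m : ℕ} {S lhat : Expo r} (hS : S ≠ 0) (hm : m ≤ d)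
    (h : toDegLex (m • S) ≤ toDegLex lhat) : m ≤ mBound d S lhat := by
  refine le_min hm (le_csSup ⟨lhat.degree, ?_⟩ h)
  intro m' hm'
  have h1 := degree_le_of_grLex_le (hm' : toDegLex (m' • S) ≤ toDegLex lhat)
  rw [map_nsmul, smul_eq_mul] at h1
  have h2 : 0 < S.degree := Nat.pos_of_ne_zero fun h0 => hS ((Finsupp.degree_eq_zero_iff S).1 h0)
  exact (Nat.le_mul_of_pos_right m' h2).trans h1

theorem EIdx.Admissible.lhat_eq {d : ℕ} {S ι : Expo r} {x : EIdx r} (hx : x.Admissible d S ι) :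
    x.m • S + gSingle x.L + x.i = x.lhat := by
  have h := hx.2.2.2.2.2.2
  apply toZ_injective
  rw [toZ_add, toZ_add, h, toZ_nsmul, natCast_zsmul]
  abel

theorem finite_degree_le (r D : ℕ) : {a : Expo r | a.degree ≤ D}.Finite := by
  refine (Set.finite_Iic (Finsupp.equivFunOnFinite.symm fun _ => D)).subset ?_
  intro b hb t
  simpa using (Finsupp.le_degree t b).trans hb

theorem finite_finsupp {α : Type*} {s : Set α} (hs : s.Finite) (D : ℕ) :
    {N : α →₀ ℕ | (∀ x ∈ N.support, x ∈ s) ∧ N.degree ≤ D}.Finite := by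
  classical
  refine ((Finset.range (D + 1)).biUnion fun q =>
    Finset.finsuppAntidiag hs.toFinset q).finite_toSet.subset ?_
  rintro N ⟨hN, hD⟩
  simp only [Finset.coe_biUnion, Set.mem_iUnion, Finset.mem_coe, Finset.mem_range]
  exact ⟨N.degree, by omega, mem_finsuppAntidiag_iff.2
    ⟨rfl, fun x hx => hs.mem_toFinset.2 (hN x hx)⟩⟩

theorem finite_admissible (d : ℕ) (S ι : Expo r) (D : ℕ) :
    {x : EIdx r | x.Admissible d S ι ∧ x.lhat.degree ≤ D}.Finite := by
  have h := ((finite_degree_le r D).prod (Set.finite_Iic d)).prod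
    (((finite_degree_le r D).prod (Set.finite_Iic d)).prod
      (finite_finsupp (finite_grLex_le S) d))
  refine (h.image fun y => (⟨y.1.1, y.1.2, y.2.1.1, y.2.1.2, y.2.2⟩ : EIdx r)).subset ?_
  rintro x ⟨hx, hD⟩
  refine ⟨((x.lhat, x.m), ((x.i, x.j), x.L)), ⟨⟨hD, ?_⟩, ⟨?_, ?_⟩, ?_⟩, rfl⟩
  · exact hx.2.2.1.trans hx.2.2.2.1
  · have h1 := congrArg Finsupp.degree hx.lhat_eq
    rw [map_add] at h1
    show x.i.degree ≤ D
    omega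
  · exact hx.2.2.2.1
  · refine ⟨hx.2.2.2.2.1, ?_⟩
    have h1 := hx.2.2.2.2.2.1
    have h2 := hx.2.2.2.1
    show x.L.degree ≤ d
    omega

/-- The number `j! / (m! L!)` attached to an index, for `|L| = j - m`. -/
noncomputable def EIdx.weight (x : EIdx r) : ℕ := x.j.choose x.m * x.L.multinomial

theorem EIdx.Admissible.cast_weight {d : ℕ} {S ι : Expo r} {x : EIdx r}
    (hx : x.Admissible d S ι) :
    (x.j.factorial : ℚ) / ((x.m.factorial : ℚ) * (factProd x.L : ℚ)) = (x.weight : ℚ) := by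
  rw [div_eq_iff (mul_ne_zero (by exact_mod_cast x.m.factorial_ne_zero)
    (by exact_mod_cast factProd_ne_zero x.L)), EIdx.weight]
  have h1 := Nat.choose_mul_factorial_mul_factorial hx.2.2.1
  have h2 := factProd_mul_multinomial x.L
  rw [hx.2.2.2.2.2.1] at h2
  rw [← h2] at h1
  rw [← h1]
  push_cast; ring

/-- The exponent `l = lhat - ι ∈ ℤ^r` of an index. -/
def EIdx.expo (ι : Expo r) (x : EIdx r) : Fin r → ℤ := toZ x.lhat - toZ ι

open Polynomial

theorem initialPart_eq_sum (y₀ : PS r K) (k : Expo r) :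
    initialPart y₀ k = ∑ i ∈ (finite_grLex_le k).toFinset,
      MvPowerSeries.monomial i (MvPowerSeries.coeff i y₀) := by
  classical
  ext n
  rw [coeff_initialPart, map_sum]
  simp only [MvPowerSeries.coeff_monomial]
  rw [Finset.sum_ite_eq]
  simp

theorem prod_monomial_pow (y₀ : PS r K) (L : Expo r →₀ ℕ) :
    (L.prod fun i c => MvPowerSeries.monomial i (MvPowerSeries.coeff i y₀) ^ c) =
      MvPowerSeries.monomial (gSingle L) (monC y₀ L) := by
  simp only [MvPowerSeries.monomial_pow]
  rw [Finsupp.prod, MvPowerSeries.prod_monomial]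
  rfl

theorem initialPart_pow (y₀ : PS r K) (k : Expo r) (e : ℕ) :
    initialPart y₀ k ^ e = ∑ L ∈ Finset.finsuppAntidiag (finite_grLex_le k).toFinset e,
      MvPowerSeries.monomial (gSingle L) ((L.multinomial : K) * monC y₀ L) := by
  rw [initialPart_eq_sum, sum_pow_eq_sum_finsuppAntidiag]
  refine Finset.sum_congr rfl fun L _ => ?_
  rw [prod_monomial_pow, ← nsmul_eq_mul, ← map_nsmul, nsmul_eq_mul]

theorem hasseDeriv_eval_eq_sum {R : Type*} [CommRing R] {P : R[X]} {d : ℕ}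
    (hd : P.natDegree ≤ d) (m : ℕ) (z : R) :
    (hasseDeriv m P).eval z =
      ∑ j ∈ Finset.range (d + 1), (j.choose m : R) * P.coeff j * z ^ (j - m) := by
  rw [hasseDeriv_apply, Polynomial.sum_over_range' _ (by simp) (d + 1) (by omega),
    eval_finsetSum]
  simp only [eval_monomial]

/-- The coefficients of `P_k(u, y + c_{S(k)})`, as sums over the pairs `(j, L)`. -/
theorem coeff_coeff_centred {P : (PS r K)[X]} {d : ℕ} (hd : P.natDegree ≤ d) (y₀ : PS r K)
    (k : Expo r) (m : ℕ) (lhat : Expo r) :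
    MvPowerSeries.coeff lhat ((centred P y₀ k).coeff m) =
      ∑ y ∈ (Finset.range (d + 1)).sigma fun j =>
          Finset.finsuppAntidiag (finite_grLex_le (grSucc k)).toFinset (j - m),
        if m • grSucc k + gSingle y.2 ≤ lhat then
          ((y.1.choose m * y.2.multinomial : ℕ) : K) *
            MvPowerSeries.coeff (lhat - (m • grSucc k + gSingle y.2)) (P.coeff y.1) * monC y₀ y.2
        else 0 := by
  rw [coeff_centred, hasseDeriv_eval_eq_sum hd, Finset.mul_sum, map_sum, Finset.sum_sigma]
  refine Finset.sum_congr rfl fun j _ => ?_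
  rw [initialPart_pow, Finset.mul_sum, Finset.mul_sum, map_sum]
  refine Finset.sum_congr rfl fun L _ => ?_
  have : MvPowerSeries.monomial (m • grSucc k) (1 : K) * ((j.choose m : PS r K) * P.coeff j *
      MvPowerSeries.monomial (gSingle L) ((L.multinomial : K) * monC y₀ L)) =
      (j.choose m) • (MvPowerSeries.monomial (m • grSucc k + gSingle L)
        ((L.multinomial : K) * monC y₀ L) * P.coeff j) := by
    rw [nsmul_eq_mul, ← one_mul ((L.multinomial : K) * monC y₀ L),
      ← MvPowerSeries.monomial_mul_monomial, one_mul]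
    ring
  rw [this, map_nsmul, MvPowerSeries.coeff_monomial_mul, nsmul_eq_mul]
  split_ifs
  · push_cast; ring
  · rw [mul_zero]

/-- The coefficients of `P_k(u, y + c_{S(k)})`, as sums over admissible indices. -/
theorem coeff_coeff_centred_eq_sum_admissible (hr : 1 ≤ r) {P : (PS r K)[X]} {d : ℕ}
    (hd : P.natDegree ≤ d)
    (y₀ : PS r K) {k ι : Expo r} {m : ℕ} {lhat : Expo r} (hl : toDegLex ι < toDegLex lhat)
    {A : Finset (EIdx r)} (hA : ∀ x, x ∈ A ↔ x.Admissible d (grSucc k) ι ∧ x.lhat = lhat ∧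
      x.m = m) :
    MvPowerSeries.coeff lhat ((centred P y₀ k).coeff m) =
      ∑ x ∈ A, (x.weight : K) * MvPowerSeries.coeff x.i (P.coeff x.j) * monC y₀ x.L := by
  have hS : grSucc k ≠ 0 := by
    intro h
    have := lt_grSucc hr k
    rw [h] at this
    exact not_lt_bot this
  rw [coeff_coeff_centred hd, ← Finset.sum_filter]
  rw [← Finset.sum_filter_of_ne (p := fun y : (_ : ℕ) × (Expo r →₀ ℕ) => m ≤ y.1)]
  swap
  · intro y _ hne
    by_contra h
    exact hne (by rw [Nat.choose_eq_zero_of_lt (not_le.1 h)]; simp)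
  symm
  refine Finset.sum_bij' (fun x _ => ⟨x.j, x.L⟩)
    (fun y _ => ⟨lhat, m, lhat - (m • grSucc k + gSingle y.2), y.1, y.2⟩) ?_ ?_ ?_ ?_ ?_
  · intro x hx
    obtain ⟨hx, rfl, rfl⟩ := (hA x).1 hx
    simp only [Finset.mem_filter, Finset.mem_sigma, Finset.mem_range]
    refine ⟨⟨⟨Nat.lt_succ_of_le hx.2.2.2.1, ?_⟩, ?_⟩, hx.2.2.1⟩
    · rw [mem_finsuppAntidiag_iff]
      exact ⟨hx.2.2.2.2.2.1, fun i hi => (Set.Finite.mem_toFinset _).2 (hx.2.2.2.2.1 i hi)⟩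
    · rw [← hx.lhat_eq]; exact le_self_add
  · rintro ⟨j, L⟩ hy
    simp only [Finset.mem_filter, Finset.mem_sigma, Finset.mem_range,
      mem_finsuppAntidiag_iff] at hy
    obtain ⟨⟨⟨hj, hLd, hLs⟩, hle⟩, hmj⟩ := hy
    rw [hA]
    refine ⟨⟨grSucc_le hl, mBound_spec hS (hmj.trans (Nat.le_of_lt_succ hj)) ?_, hmj,
      Nat.le_of_lt_succ hj, fun i hi => ?_, hLd, ?_⟩, rfl, rfl⟩
    · show toDegLex (m • grSucc k) ≤ toDegLex lhat
      rw [← tsub_add_cancel_of_le hle, add_comm, add_assoc]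
      exact le_of_grLex_add
    · exact (finite_grLex_le (grSucc k)).mem_toFinset.1 (hLs hi)
    · show toZ (gSingle L) = toZ lhat - (m : ℤ) • toZ (grSucc k) -
        toZ (lhat - (m • grSucc k + gSingle L))
      have h1 : toZ (lhat - (m • grSucc k + gSingle L)) + (m • toZ (grSucc k) + toZ (gSingle L)) =
          toZ lhat := by
        rw [← toZ_nsmul, ← toZ_add, ← toZ_add, tsub_add_cancel_of_le hle]
      rw [← h1, natCast_zsmul]
      abel
  · intro x hx
    obtain ⟨hx, rfl, rfl⟩ := (hA x).1 hx
    have h1 : x.lhat - (x.m • grSucc k + gSingle x.L) = x.i := by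
      conv_lhs => rw [← hx.lhat_eq]
      exact add_tsub_cancel_left _ _
    simp only [h1]
  · intro y _
    rfl
  · intro x hx
    obtain ⟨hx, rfl, rfl⟩ := (hA x).1 hx
    have h1 : x.lhat - (x.m • grSucc k + gSingle x.L) = x.i := by
      conv_lhs => rw [← hx.lhat_eq]
      exact add_tsub_cancel_left _ _
    simp only [h1, EIdx.weight]

end Indices

/-! ### Truncation of `Q_k` -/

section Truncation

open Polynomial

theorem coeff_coeff_sum_monomial_pow {Γ : Type*} [AddCommGroup Γ] [PartialOrder Γ]
    [IsOrderedCancelAddMonoid Γ] {K : Type*} [Field K] {α : Type*} [DecidableEq α] [DecidableEq Γ]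
    (s : Finset α) (m : α → ℕ) (l : α → Γ) (β : α → K) (q j : ℕ) (n : Γ) :
    (((∑ x ∈ s, monomial (m x) (HahnSeries.single (l x) (β x))) ^ q).coeff j).coeff n =
      ∑ N ∈ Finset.finsuppAntidiag s q with
          (N.sum fun x c => c * m x) = j ∧ (N.sum fun x c => c • l x) = n,
        (N.multinomial : K) * N.prod fun x c => β x ^ c := by
  have hprod : ∀ N : α →₀ ℕ,
      (N.prod fun x c => (monomial (m x) (HahnSeries.single (l x) (β x))) ^ c) =
        monomial (N.sum fun x c => c * m x)
          (HahnSeries.single (N.sum fun x c => c • l x) (N.prod fun x c => β x ^ c)) := by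
    intro N
    simp only [monomial_pow, HahnSeries.single_pow, Finsupp.prod, Finsupp.sum]
    induction N.support using Finset.induction_on with
    | empty => simp
    | insert x t hx ih =>
      rw [Finset.prod_insert hx, ih, monomial_mul_monomial, HahnSeries.single_mul_single,
        Finset.sum_insert hx, Finset.sum_insert hx, Finset.prod_insert hx, mul_comm (m x)]
  rw [sum_pow_eq_sum_finsuppAntidiag, finsetSum_coeff, HahnSeries.coeff_sum, Finset.sum_filter]
  refine Finset.sum_congr rfl fun N _ => ?_
  rw [hprod, ← nsmul_eq_mul, coeff_smul, coeff_monomial, HahnSeries.coeff_smul]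
  by_cases hj : (N.sum fun x c => c * m x) = j
  · rw [if_pos hj, HahnSeries.coeff_single]
    by_cases hn : (N.sum fun x c => c • l x) = n
    · rw [if_pos hn.symm, if_pos ⟨hj, hn⟩, nsmul_eq_mul]
    · rw [if_neg (Ne.symm hn), if_neg fun h => hn h.2, smul_zero]
  · rw [if_neg hj, if_neg fun h => hj h.1, HahnSeries.coeff_zero, smul_zero]

/-- For polynomials with coefficients of nonnegative weight, the coefficients of weight at most `N`
of a power depend only on the coefficients of weight at most `N`. -/
theorem coeff_coeff_pow_congr {Γ : Type*} [AddCommGroup Γ] [PartialOrder Γ]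
    [IsOrderedCancelAddMonoid Γ] {K : Type*} [Field K] {φ : Γ →+ ℤ} {A B : (HahnSeries Γ K)[X]}
    (hA : ∀ m, WeightGE φ 0 (A.coeff m)) (hB : ∀ m, WeightGE φ 0 (B.coeff m)) {N : ℤ}
    (hAB : ∀ m l, φ l ≤ N → (A.coeff m).coeff l = (B.coeff m).coeff l) (q j : ℕ) {n : Γ}
    (hn : φ n ≤ N) : ((A ^ q).coeff j).coeff n = ((B ^ q).coeff j).coeff n := by
  have hsub : ∀ m, WeightGE φ (N + 1) ((A - B).coeff m) := by
    intro m l hl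
    by_contra h
    exact hl (by rw [coeff_sub, HahnSeries.coeff_sub, hAB m l (by omega), sub_self])
  have hpow : ∀ q m, WeightGE φ (N + 1) ((A ^ q - B ^ q).coeff m) := by
    intro q
    induction q with
    | zero => intro m; simpa using WeightGE.zero _
    | succ q ih =>
      intro m
      have e : A ^ (q + 1) - B ^ (q + 1) = (A ^ q - B ^ q) * A + B ^ q * (A - B) := by ring
      rw [e, coeff_add]
      refine WeightGE.add ?_ ?_
      · simpa using weightGE_coeff_mul ih hA m
      · have h := weightGE_coeff_mul (a := (0 : ℤ))
          (fun i => by simpa using weightGE_coeff_pow hB q i) hsub m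
        rwa [zero_add] at h
  by_contra hne
  have h := hpow q j n (by rw [coeff_sub, HahnSeries.coeff_sub]; exact sub_ne_zero.2 hne)
  omega

variable {r : ℕ} {K : Type*} [Field K]

/-- The contribution of an index to the coefficients of `Q_k`. -/
noncomputable def EIdx.term (P : (PS r K)[X]) (y₀ : PS r K) (x : EIdx r) : K :=
  -1 / omegaZero P y₀ *
    ((x.weight : K) * MvPowerSeries.coeff x.i (P.coeff x.j) * monC y₀ x.L)

/-- Up to weight `N`, the coefficients of `Q_k` are those of a finite sum of monomials, one for each
admissible index. -/
theorem coeffQ_eq_sum_term (hr : 1 ≤ r) {P : (PS r K)[X]} {d : ℕ} (hd : P.natDegree ≤ d)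
    {y₀ : PS r K} {k : Expo r} (hω : omegaZero P y₀ ≠ 0)
    (hG : ∀ m, ValGE (iota P y₀ k) ((centred P y₀ k).coeff m) ∧
      MvPowerSeries.coeff (iota P y₀ k) ((centred P y₀ k).coeff m) =
        if m = 1 then omegaZero P y₀ else 0)
    {φ : (Fin r → ℤ) →+ ℤ} {N : ℤ} {A : Finset (EIdx r)}
    (hA : ∀ x, x ∈ A ↔ x.Admissible d (grSucc k) (iota P y₀ k) ∧ φ (x.expo (iota P y₀ k)) ≤ N)
    {l : Fin r → ℤ} (hl : φ l ≤ N) (m : ℕ) :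
    coeffQ P y₀ k l m =
      ∑ x ∈ A with x.m = m ∧ x.expo (iota P y₀ k) = l, x.term P y₀ := by
  classical
  by_cases hn : ∃ n, toZ n = l + toZ (iota P y₀ k) ∧ toDegLex (iota P y₀ k) < toDegLex n
  · obtain ⟨n, hn, hlt⟩ := hn
    have hex : ∃ n : Expo r, toZ n = l + toZ (iota P y₀ k) := ⟨n, hn⟩
    have hch : hex.choose = n := toZ_injective (hex.choose_spec.trans hn.symm)
    have hl0 : l ≠ 0 := by
      rintro rfl
      rw [zero_add] at hn
      rw [toZ_injective hn] at hlt
      exact lt_irrefl _ hlt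
    have hexpo : ∀ x : EIdx r, x.expo (iota P y₀ k) = l ↔ x.lhat = n := by
      intro x
      rw [EIdx.expo, sub_eq_iff_eq_add, ← hn, toZ_injective.eq_iff]
    rw [coeffQ, if_neg fun h => hl0 h.1, add_zero, coeffR, dif_pos hex, hch, shifted_comp hr,
      coeff_coeff_centred_eq_sum_admissible hr hd y₀ hlt (A := A.filter fun x =>
        x.m = m ∧ x.expo (iota P y₀ k) = l), Finset.sum_div]
    · refine Finset.sum_congr rfl fun x _ => ?_
      rw [EIdx.term, div_neg, div_eq_mul_inv, div_eq_mul_inv]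
      ring
    · intro x
      rw [Finset.mem_filter, hA, hexpo]
      constructor
      · rintro ⟨⟨h1, -⟩, h2, h3⟩
        exact ⟨h1, h3, h2⟩
      · rintro ⟨h1, h3, h2⟩
        exact ⟨⟨h1, by rw [(hexpo x).2 h3]; exact hl⟩, h2, h3⟩
  · rw [Finset.sum_eq_zero]
    · by_contra hne
      exact hn (exists_of_coeffQ_ne_zero hr hω hG hne)
    · intro x hx
      obtain ⟨hxA, -, rfl⟩ := Finset.mem_filter.1 hx
      refine absurd ⟨x.lhat, ?_, ?_⟩ hn
      · rw [EIdx.expo, sub_add_cancel]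
      · exact (lt_grSucc hr _).trans_le ((hA x).1 hxA).1.1

end Truncation

/-! ### Grouping the tuples of indices -/

section Tuples

variable {r : ℕ} {K : Type*} [Field K]

/-- The tuples `N` of admissible indices with `|N| = q`, `∑ N m = q - 1` and `∑ N l = n`. They index
the expansion of the coefficient of `u^n y^{q-1}` in `Q_k^q`. -/
def NTuples (d : ℕ) (S ι : Expo r) (n : Fin r → ℤ) (q : ℕ) : Set (EIdx r →₀ ℕ) :=
  {N | (∀ x ∈ N.support, x.Admissible d S ι) ∧ N.degree = q ∧
    (N.sum fun x c => c * x.m) + 1 = q ∧ (N.sum fun x c => c • x.expo ι) = n}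

/-- The tuple `(s_{i,j})` attached to a tuple of indices. -/
noncomputable def STuple (N : EIdx r →₀ ℕ) : (Expo r × ℕ) →₀ ℕ := N.mapDomain fun x => (x.i, x.j)

/-- The tuple `(t_i)` attached to a tuple of indices. -/
noncomputable def TTuple (N : EIdx r →₀ ℕ) : Expo r →₀ ℕ := N.sum fun x c => c • x.L

theorem yWeight_STuple (N : EIdx r →₀ ℕ) : yWeight (STuple N) = N.sum fun x c => c * x.j :=
  Finsupp.sum_mapDomain_index (by simp) (by intros; ring)

theorem gPair_STuple (N : EIdx r →₀ ℕ) : gPair (STuple N) = N.sum fun x c => c • x.i :=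
  Finsupp.sum_mapDomain_index (by simp) (by intros; rw [add_smul])

theorem degree_STuple (N : EIdx r →₀ ℕ) : (STuple N).degree = N.degree :=
  Finsupp.sum_mapDomain_index (h := fun _ c => c) (by simp) (by simp)

theorem degree_TTuple (N : EIdx r →₀ ℕ) :
    (TTuple N).degree = N.sum fun x c => c * x.L.degree := by
  rw [TTuple, Finsupp.sum, map_sum]
  simp only [map_nsmul, smul_eq_mul]
  rfl

theorem gSingle_add (L L' : Expo r →₀ ℕ) : gSingle (L + L') = gSingle L + gSingle L' :=
  Finsupp.sum_add_index' (by simp) (by intros; rw [add_smul])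

theorem gSingle_nsmul (c : ℕ) (L : Expo r →₀ ℕ) : gSingle (c • L) = c • gSingle L := by
  induction c with
  | zero => simp [gSingle]
  | succ c ih => rw [succ_nsmul, gSingle_add, ih, succ_nsmul]

theorem gSingle_TTuple (N : EIdx r →₀ ℕ) :
    gSingle (TTuple N) = N.sum fun x c => c • gSingle x.L := by
  classical
  rw [TTuple, Finsupp.sum, Finsupp.sum]
  induction N.support using Finset.induction_on with
  | empty => simp [gSingle]
  | insert x t hx ih =>
    rw [Finset.sum_insert hx, Finset.sum_insert hx, gSingle_add, gSingle_nsmul, ih]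

theorem monC_add (y₀ : PS r K) (L L' : Expo r →₀ ℕ) :
    monC y₀ (L + L') = monC y₀ L * monC y₀ L' :=
  Finsupp.prod_add_index' (by simp) (by intros; rw [pow_add])

theorem monC_nsmul (y₀ : PS r K) (c : ℕ) (L : Expo r →₀ ℕ) :
    monC y₀ (c • L) = monC y₀ L ^ c := by
  induction c with
  | zero => simp [monC]
  | succ c ih => rw [succ_nsmul, monC_add, ih, pow_succ]

theorem monC_TTuple (y₀ : PS r K) (N : EIdx r →₀ ℕ) :
    monC y₀ (TTuple N) = N.prod fun x c => monC y₀ x.L ^ c := by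
  classical
  rw [TTuple, Finsupp.sum, Finsupp.prod]
  induction N.support using Finset.induction_on with
  | empty => simp [monC]
  | insert x t hx ih =>
    rw [Finset.sum_insert hx, Finset.prod_insert hx, monC_add, monC_nsmul, ih]

theorem monA_STuple (P : Polynomial (PS r K)) (N : EIdx r →₀ ℕ) :
    monA P (STuple N) = N.prod fun x c => MvPowerSeries.coeff x.i (P.coeff x.j) ^ c :=
  Finsupp.prod_mapDomain_index (by simp) (by intros; rw [pow_add])

theorem prod_term_pow (P : Polynomial (PS r K)) (y₀ : PS r K) (N : EIdx r →₀ ℕ) :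
    (N.prod fun x c => x.term P y₀ ^ c) = (-1 / omegaZero P y₀) ^ N.degree *
      ((N.prod fun x c => (x.weight : K) ^ c) * monA P (STuple N) * monC y₀ (TTuple N)) := by
  rw [monA_STuple, monC_TTuple, Finsupp.degree_apply, ← Finset.prod_pow_eq_pow_sum]
  simp only [EIdx.term, mul_pow, Finsupp.prod, Finset.prod_mul_distrib]

variable {d : ℕ} {S ι : Expo r}

theorem degree_TTuple_add {N : EIdx r →₀ ℕ} (hN : ∀ x ∈ N.support, x.Admissible d S ι) :
    (TTuple N).degree + (N.sum fun x c => c * x.m) = yWeight (STuple N) := by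
  rw [degree_TTuple, yWeight_STuple, Finsupp.sum, Finsupp.sum, Finsupp.sum,
    ← Finset.sum_add_distrib]
  refine Finset.sum_congr rfl fun x hx => ?_
  rw [(hN x hx).2.2.2.2.2.1, ← mul_add, Nat.sub_add_cancel (hN x hx).2.2.1]

theorem toZ_gSingle_TTuple_add {N : EIdx r →₀ ℕ}
    (hN : ∀ x ∈ N.support, x.Admissible d S ι) :
    toZ (gSingle (TTuple N)) + toZ (gPair (STuple N)) + (N.sum fun x c => c * x.m) • toZ S =
      (N.sum fun x c => c • x.expo ι) + N.degree • toZ ι := by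
  have hz : ∀ f : EIdx r → Expo r, toZ (∑ x ∈ N.support, N x • f x) =
      ∑ x ∈ N.support, N x • toZ (f x) := by
    intro f
    rw [show toZ (∑ x ∈ N.support, N x • f x) = toZHom r (∑ x ∈ N.support, N x • f x) from rfl,
      map_sum]
    simp only [map_nsmul]
    rfl
  rw [gSingle_TTuple, gPair_STuple, Finsupp.degree_apply]
  simp only [Finsupp.sum]
  rw [hz, hz, Finset.sum_smul, Finset.sum_smul, ← Finset.sum_add_distrib,
    ← Finset.sum_add_distrib, ← Finset.sum_add_distrib]
  refine Finset.sum_congr rfl fun x hx => ?_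
  rw [EIdx.expo, ← (hN x hx).lhat_eq, toZ_add, toZ_add, toZ_nsmul, mul_smul, ← smul_add,
    ← smul_add, ← smul_add]
  congr 1
  abel

/-- The conditions on `S` and `T` in the double sum say exactly that the tuples `N` counted by `e_T`
contribute to the coefficient of `u^n y^{q-1}` in `Q_k^q`. -/
theorem mem_NTuples_of_mem_ETuples {n : Fin r → ℤ} {q : ℕ} {S' : (Expo r × ℕ) →₀ ℕ}
    {T : Expo r →₀ ℕ} (hT : T ∈ TIndex S ι n q S') {N : EIdx r →₀ ℕ}
    (hN : N ∈ ETuples d S ι q S' T) : N ∈ NTuples d S ι n q := by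
  obtain ⟨hadm, rfl, hq, rfl⟩ := hN
  obtain ⟨-, hd, hg⟩ := hT
  change (TTuple N).degree + q = yWeight (STuple N) + 1 at hd
  change toZ (gSingle (TTuple N)) = n + (q : ℤ) • toZ ι - ((q : ℤ) - 1) • toZ S -
    toZ (gPair (STuple N)) at hg
  have h1 := degree_TTuple_add hadm
  have h2 := toZ_gSingle_TTuple_add hadm
  have h3 : (N.sum fun x c => c * x.m) + 1 = q := by omega
  refine ⟨hadm, hq, h3, ?_⟩
  rw [hg, hq, ← natCast_zsmul, ← natCast_zsmul (toZ ι) q,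
    show ((q : ℤ) - 1) = ((N.sum fun x c => c * x.m : ℕ) : ℤ) by omega] at h2
  rw [eq_comm, ← add_left_inj ((q : ℤ) • toZ ι), ← h2]
  abel

theorem STuple_mem_SIndex {n : Fin r → ℤ} {q : ℕ} {N : EIdx r →₀ ℕ}
    (hN : N ∈ NTuples d S ι n q) : STuple N ∈ SIndex r d q := by
  classical
  obtain ⟨hadm, hq, hm, -⟩ := hN
  refine ⟨fun x hx => ?_, by rw [degree_STuple, hq], ?_⟩
  · obtain ⟨y, hy, rfl⟩ := Finset.mem_image.1 (Finsupp.mapDomain_support hx)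
    exact (hadm y hy).2.2.2.1
  · have := degree_TTuple_add hadm
    omega

theorem TTuple_mem_TIndex {n : Fin r → ℤ} {q : ℕ} {N : EIdx r →₀ ℕ}
    (hN : N ∈ NTuples d S ι n q) : TTuple N ∈ TIndex S ι n q (STuple N) := by
  classical
  obtain ⟨hadm, hq, hm, hn⟩ := hN
  have h1 := degree_TTuple_add hadm
  have h2 := toZ_gSingle_TTuple_add hadm
  refine ⟨fun i hi => ?_, by omega, ?_⟩
  · have hi' : TTuple N i ≠ 0 := Finsupp.mem_support_iff.1 hi
    rw [TTuple, Finsupp.sum_apply] at hi'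
    obtain ⟨x, hx, hne⟩ := Finset.exists_ne_zero_of_sum_ne_zero hi'
    refine (hadm x hx).2.2.2.2.1 i (Finsupp.mem_support_iff.2 fun h => hne ?_)
    show (N x • x.L) i = 0
    rw [Finsupp.smul_apply, h, smul_zero]
  · rw [hn, hq, ← natCast_zsmul, ← natCast_zsmul (toZ ι) q,
      show ((N.sum fun x c => c * x.m : ℕ) : ℤ) = (q : ℤ) - 1 by omega] at h2
    rw [← h2]
    abel

theorem mem_ETuples_of_mem_NTuples {n : Fin r → ℤ} {q : ℕ} {N : EIdx r →₀ ℕ}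
    (hN : N ∈ NTuples d S ι n q) : N ∈ ETuples d S ι q (STuple N) (TTuple N) :=
  ⟨hN.1, rfl, hN.2.1, rfl⟩

/-- Summation by fibers, with the index set of the fibers given as a possibly infinite set. -/
theorem finsum_mem_sum_filter {α β M : Type*} [AddCommMonoid M] [DecidableEq β] (F : Finset α)
    {t : α → β} {U : Set β} (hU : ∀ a ∈ F, t a ∈ U) (f : α → M) :
    ∑ᶠ b ∈ U, ∑ a ∈ F with t a = b, f a = ∑ a ∈ F, f a := by
  rw [← Finset.sum_fiberwise_of_maps_to (t := F.image t)
    (fun a ha => Finset.mem_image_of_mem t ha)]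
  refine finsum_mem_eq_sum_of_inter_support_eq _ ?_
  ext b
  simp only [Set.mem_inter_iff, Function.mem_support, Finset.mem_coe, Finset.mem_image]
  refine and_congr_left fun hb => ?_
  obtain ⟨a, ha, -⟩ := Finset.exists_ne_zero_of_sum_ne_zero hb
  obtain ⟨haF, rfl⟩ := Finset.mem_filter.1 ha
  exact ⟨fun _ => ⟨a, haF, rfl⟩, fun _ => hU a haF⟩

/-- The term of `e_T` attached to a tuple, as a natural number. -/
noncomputable def tupleWeight (N : EIdx r →₀ ℕ) : ℕ :=
  N.multinomial * N.prod fun x c => x.weight ^ c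

theorem eCoeff_eq_finsum (q : ℕ) (S' : (Expo r × ℕ) →₀ ℕ) (T : Expo r →₀ ℕ) :
    eCoeff d S ι q S' T = ∑ᶠ N ∈ ETuples d S ι q S' T, (tupleWeight N : ℚ) := by
  refine finsum_mem_congr rfl fun N hN => ?_
  rw [← hN.2.2.1, factorial_div_factProd, tupleWeight, Nat.cast_mul, Finsupp.prod, Finsupp.prod,
    Nat.cast_prod]
  congr 1
  refine Finset.prod_congr rfl fun x hx => ?_
  rw [(hN.1 x hx).cast_weight, Nat.cast_pow]

theorem finite_ETuples (q : ℕ) (S' : (Expo r × ℕ) →₀ ℕ) (T : Expo r →₀ ℕ) :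
    (ETuples d S ι q S' T).Finite := by
  classical
  -- the equation `g(L) = lhat - m S - i` bounds `lhat` in terms of `S'` and `T`
  set D := d * S.degree + (gSingle T).degree + (gPair S').degree with hD
  refine (finite_finsupp (finite_admissible d S ι D) q).subset ?_
  rintro N ⟨hadm, rfl, hq, rfl⟩
  refine ⟨fun x hx => ⟨hadm x hx, ?_⟩, hq.le⟩
  have h1 := congrArg Finsupp.degree (hadm x hx).lhat_eq
  rw [map_add, map_add, map_nsmul, smul_eq_mul] at h1
  have h2 : x.m * S.degree ≤ d * S.degree :=
    Nat.mul_le_mul_right _ ((hadm x hx).2.2.1.trans (hadm x hx).2.2.2.1)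
  have hNx : 1 ≤ N x := Nat.one_le_iff_ne_zero.2 (Finsupp.mem_support_iff.1 hx)
  have key : ∀ f : EIdx r → Expo r, (f x).degree ≤ (N.sum fun x c => c • f x).degree := by
    intro f
    rw [Finsupp.sum, map_sum]
    refine le_trans ?_ (Finset.single_le_sum (f := fun y => (N y • f y).degree)
      (fun _ _ => Nat.zero_le _) hx)
    simp only [map_nsmul, smul_eq_mul]
    exact Nat.le_mul_of_pos_left _ hNx
  have h3 := key fun x => gSingle x.L
  have h4 := key fun x => x.i
  rw [← gSingle_TTuple] at h3
  rw [← gPair_STuple] at h4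
  change x.lhat.degree ≤ d * S.degree + (gSingle (TTuple N)).degree + (gPair (STuple N)).degree
  omega

theorem finite_SIndex_TIndex (S ι : Expo r) (d : ℕ) (n : Fin r → ℤ) (q : ℕ) :
    {ST : ((Expo r × ℕ) →₀ ℕ) × (Expo r →₀ ℕ) |
      ST.1 ∈ SIndex r d q ∧ ST.2 ∈ TIndex S ι n q ST.1}.Finite := by
  -- the equation for `g(T)` bounds `g(S')` coordinatewise
  set b : Expo r := Finsupp.equivFunOnFinite.symm fun t =>
    (n t + q * ι t - ((q : ℤ) - 1) * S t).toNat with hb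
  refine ((finite_finsupp ((finite_degree_le r b.degree).prod (Set.finite_Iic d)) q).prod
    (finite_finsupp (finite_grLex_le S) (q * d + 1))).subset ?_
  rintro ⟨S', T⟩ ⟨⟨hS1, hS2, hS3⟩, ⟨hT1, hT2, hT3⟩⟩
  have hle : gPair S' ≤ b := by
    intro t
    have h := congrFun hT3 t
    simp only [toZ, Pi.add_apply, Pi.sub_apply, Pi.smul_apply, smul_eq_mul] at h
    have h' : b t = (n t + q * ι t - ((q : ℤ) - 1) * S t).toNat := rfl
    rw [h']
    omega
  refine ⟨⟨fun x hx => ⟨?_, hS1 x hx⟩, hS2.le⟩, hT1, ?_⟩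
  · refine le_trans ?_ (Finsupp.degree_mono hle)
    rw [gPair, Finsupp.sum, map_sum]
    refine le_trans ?_ (Finset.single_le_sum (f := fun y => (S' y • y.1).degree)
      (fun _ _ => Nat.zero_le _) hx)
    simp only [map_nsmul, smul_eq_mul]
    exact Nat.le_mul_of_pos_left _ (Nat.pos_of_ne_zero (Finsupp.mem_support_iff.1 hx))
  · have : yWeight S' ≤ q * d := by
      rw [← hS2, Finsupp.degree_apply, Finset.sum_mul]
      exact Finset.sum_le_sum fun x hx => Nat.mul_le_mul_left _ (hS1 x hx)
    change T.degree + q = yWeight S' + 1 at hT2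
    show T.degree ≤ q * d + 1
    omega

/-- Every summand of `e_T` is divisible by `q`. -/
theorem exists_natCast_eq_eCoeff {n : Fin r → ℤ} {q : ℕ} (hq : 1 ≤ q)
    {S' : (Expo r × ℕ) →₀ ℕ} {T : Expo r →₀ ℕ} (hT : T ∈ TIndex S ι n q S') :
    ∃ N : ℕ, (1 / (q : ℚ)) * eCoeff d S ι q S' T = (N : ℚ) := by
  have hfin := finite_ETuples (d := d) (S := S) (ι := ι) q S' T
  rw [eCoeff_eq_finsum, finsum_mem_eq_finite_toFinset_sum _ hfin, ← Nat.cast_sum]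
  have hdvd : q ∣ ∑ N ∈ hfin.toFinset, tupleWeight N := by
    refine Finset.dvd_sum fun N hN => ?_
    obtain ⟨-, h1, h2, -⟩ := mem_NTuples_of_mem_ETuples hT (hfin.mem_toFinset.1 hN)
    subst h1
    exact (dvd_multinomial_of_weight (fun x => x.m) h2).mul_right _
  obtain ⟨M, hM⟩ := hdvd
  refine ⟨M, ?_⟩
  have hq0 : (q : ℚ) ≠ 0 := Nat.cast_ne_zero.2 (by omega)
  rw [hM, Nat.cast_mul, one_div, inv_mul_cancel_left₀ hq0]

/-- Grouping the tuples `N` according to `(S, T)`. -/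
theorem sum_NTuples_eq_finsum [CharZero K] (P : Polynomial (PS r K)) (y₀ : PS r K)
    {n : Fin r → ℤ} {q : ℕ} {F : Finset (EIdx r →₀ ℕ)} (hF : ∀ N, N ∈ F ↔ N ∈ NTuples d S ι n q) :
    ∑ N ∈ F, (N.multinomial : K) * N.prod (fun x c => x.term P y₀ ^ c) =
      (-1 / omegaZero P y₀) ^ q * ∑ᶠ S' ∈ SIndex r d q, monA P S' *
        ∑ᶠ T ∈ TIndex S ι n q S', ((eCoeff d S ι q S' T : ℚ) : K) * monC y₀ T := by
  classical
  have he : ∀ S', ∀ T ∈ TIndex S ι n q S', eCoeff d S ι q S' T =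
      ∑ N ∈ (F.filter fun N => STuple N = S') with TTuple N = T, (tupleWeight N : ℚ) := by
    intro S' T hT
    rw [eCoeff_eq_finsum, ← finsum_mem_coe_finset]
    refine finsum_mem_congr (Set.ext fun N => ?_) fun _ _ => rfl
    rw [Finset.mem_coe, Finset.mem_filter, Finset.mem_filter, hF]
    constructor
    · intro hN
      exact ⟨⟨mem_NTuples_of_mem_ETuples hT hN, hN.2.1⟩, hN.2.2.2⟩
    · rintro ⟨⟨hN, rfl⟩, rfl⟩
      exact mem_ETuples_of_mem_NTuples hN
  have hinner : ∀ S', ∑ᶠ T ∈ TIndex S ι n q S', ((eCoeff d S ι q S' T : ℚ) : K) * monC y₀ T =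
      ∑ N ∈ F with STuple N = S', (tupleWeight N : K) * monC y₀ (TTuple N) := by
    intro S'
    rw [← finsum_mem_sum_filter (t := TTuple) (U := TIndex S ι n q S')]
    · refine finsum_mem_congr rfl fun T hT => ?_
      rw [he S' T hT, Rat.cast_sum, Finset.sum_mul]
      refine Finset.sum_congr rfl fun N hN => ?_
      rw [(Finset.mem_filter.1 hN).2, Rat.cast_natCast]
    · intro N hN
      obtain ⟨hNF, rfl⟩ := Finset.mem_filter.1 hN
      exact TTuple_mem_TIndex ((hF N).1 hNF)
  have houter : ∑ᶠ S' ∈ SIndex r d q, monA P S' *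
        ∑ᶠ T ∈ TIndex S ι n q S', ((eCoeff d S ι q S' T : ℚ) : K) * monC y₀ T =
      ∑ N ∈ F, (tupleWeight N : K) * monA P (STuple N) * monC y₀ (TTuple N) := by
    rw [← finsum_mem_sum_filter F (t := STuple) (U := SIndex r d q)]
    · refine finsum_mem_congr rfl fun S' _ => ?_
      rw [hinner, Finset.mul_sum]
      refine Finset.sum_congr rfl fun N hN => ?_
      rw [(Finset.mem_filter.1 hN).2]
      ring
    · exact fun N hN => STuple_mem_SIndex ((hF N).1 hN)
  rw [houter, Finset.mul_sum]
  refine Finset.sum_congr rfl fun N hN => ?_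
  rw [prod_term_pow, ((hF N).1 hN).2.1, tupleWeight, Nat.cast_mul, Finsupp.prod, Finsupp.prod,
    Nat.cast_prod]
  simp only [Nat.cast_pow]
  ring

end Tuples

/-! ### The coefficients of the root -/

section Assembly

open Polynomial

variable {r : ℕ} {K : Type*} [Field K]

/-- The weight of `n` bounds `μ_n`, because every monomial of `Q_k` has weight at least `1`. -/
theorem le_of_mem_muSet {P : (PS r K)[X]} {y₀ : PS r K} {k : Expo r} {φ : (Fin r → ℤ) →+ ℤ}
    (hφ : ∀ l m, coeffQ P y₀ k l m ≠ 0 → 1 ≤ φ l) {n : Fin r → ℤ} {N : ℕ} (hn : φ n ≤ N) :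
    ∀ q ∈ muSet P y₀ k n, q ≤ N := by
  rintro q ⟨M, hM, rfl, -, rfl⟩
  rw [gPair, Finsupp.sum, map_sum] at hn
  have : (M.degree : ℤ) ≤ ∑ x ∈ M.support, φ (M x • x.1) := by
    rw [Finsupp.degree_apply, Nat.cast_sum]
    refine Finset.sum_le_sum fun x hx => ?_
    rw [map_nsmul, nsmul_eq_mul]
    have h1 := hφ _ _ (hM x hx)
    nlinarith [(Nat.cast_nonneg (M x) : (0 : ℤ) ≤ (M x : ℤ))]
  omega

/-- The coefficient of `u^n y^{q-1}` in `Q_k^q`, expanded by the multinomial theorem. -/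
theorem coeff_fixedPointPoly_pow [CharZero K] (hr : 1 ≤ r) {P : (PS r K)[X]} {d : ℕ}
    (hd : P.natDegree ≤ d) {y₀ : PS r K} {k : Expo r} (hω : omegaZero P y₀ ≠ 0)
    (hG : ∀ m, ValGE (iota P y₀ k) ((centred P y₀ k).coeff m) ∧
      MvPowerSeries.coeff (iota P y₀ k) ((centred P y₀ k).coeff m) =
        if m = 1 then omegaZero P y₀ else 0)
    {w : Fin r → ℕ} (hw : ∀ t, 0 < w t)
    (hι : ∀ e, toDegLex (iota P y₀ k) < toDegLex e →
      weightHom w (toZ (iota P y₀ k)) < weightHom w (toZ e))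
    (n : Fin r → ℤ) {q : ℕ} (hq : 1 ≤ q) :
    (((fixedPointPoly P y₀ k) ^ q).coeff (q - 1)).coeff n =
      (-1 / omegaZero P y₀) ^ q * ∑ᶠ S ∈ SIndex r d q, monA P S *
        ∑ᶠ T ∈ TIndex (grSucc k) (iota P y₀ k) n q S,
          ((eCoeff d (grSucc k) (iota P y₀ k) q S T : ℚ) : K) * monC y₀ T := by
  classical
  have hpos : ∀ x : EIdx r, x.Admissible d (grSucc k) (iota P y₀ k) →
      1 ≤ weightHom w (x.expo (iota P y₀ k)) := by
    intro x hx
    have := hι x.lhat ((lt_grSucc hr (iota P y₀ k)).trans_le hx.1)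
    rw [EIdx.expo, map_sub]
    omega
  have hfin : {x : EIdx r | x.Admissible d (grSucc k) (iota P y₀ k) ∧
      weightHom w (x.expo (iota P y₀ k)) ≤ weightHom w n}.Finite := by
    refine (finite_admissible d (grSucc k) (iota P y₀ k)
      (weightHom w n + weightHom w (toZ (iota P y₀ k))).toNat).subset ?_
    rintro x ⟨hx, hle⟩
    refine ⟨hx, ?_⟩
    rw [EIdx.expo, map_sub, sub_le_iff_le_add, weightHom_toZ] at hle
    have : x.lhat.degree ≤ ∑ t, w t * x.lhat t := by
      rw [Finsupp.degree_eq_sum]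
      exact Finset.sum_le_sum fun t _ => Nat.le_mul_of_pos_left _ (hw t)
    omega
  have hA : ∀ x, x ∈ hfin.toFinset ↔ x.Admissible d (grSucc k) (iota P y₀ k) ∧
      weightHom w (x.expo (iota P y₀ k)) ≤ weightHom w n :=
    fun x => hfin.mem_toFinset
  have hcongr := coeff_coeff_pow_congr (φ := weightHom w) (N := weightHom w n)
    (A := fixedPointPoly P y₀ k)
    (B := ∑ x ∈ hfin.toFinset, monomial x.m
      (HahnSeries.single (x.expo (iota P y₀ k)) (x.term P y₀)))
    (by
      intro m l hl
      rw [coeff_fixedPointPoly hr] at hl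
      obtain ⟨e, he, hlt⟩ := exists_of_coeffQ_ne_zero hr hω hG hl
      have := hι e hlt
      rw [he, map_add] at this
      omega)
    (by
      intro m
      rw [finsetSum_coeff]
      refine WeightGE.sum fun x hx l hl => ?_
      rw [coeff_monomial] at hl
      split_ifs at hl
      · rw [HahnSeries.coeff_single] at hl
        split_ifs at hl with h
        · rw [h]
          have := hpos x ((hA x).1 hx).1
          omega
        · exact absurd rfl hl
      · exact absurd rfl hl)
    (by
      intro m l hl
      rw [coeff_fixedPointPoly hr, coeffQ_eq_sum_term hr hd hω hG hA hl, finsetSum_coeff,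
        HahnSeries.coeff_sum, Finset.sum_filter]
      refine Finset.sum_congr rfl fun x _ => ?_
      rw [coeff_monomial]
      by_cases h1 : x.m = m
      · rw [if_pos h1, HahnSeries.coeff_single]
        simp [h1, eq_comm]
      · rw [if_neg h1, if_neg fun h => h1 h.1, HahnSeries.coeff_zero])
    q (q - 1) (n := n) le_rfl
  rw [hcongr, coeff_coeff_sum_monomial_pow]
  refine sum_NTuples_eq_finsum P y₀ fun N => ?_
  rw [Finset.mem_filter, mem_finsuppAntidiag_iff]
  constructor
  · rintro ⟨⟨h1, h2⟩, h3, h4⟩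
    exact ⟨fun x hx => ((hA x).1 (h2 hx)).1, h1, by omega, h4⟩
  · rintro ⟨h1, h2, h3, h4⟩
    refine ⟨⟨h2, fun x hx => (hA x).2 ⟨h1 x hx, ?_⟩⟩, by omega, h4⟩
    -- every index of `N` contributes a positive amount to the weight of `n`
    rw [← h4, Finsupp.sum, map_sum]
    have hnn : ∀ y ∈ N.support, 0 ≤ weightHom w (N y • y.expo (iota P y₀ k)) := by
      intro y hy
      rw [map_nsmul]
      exact nsmul_nonneg (by have := hpos y (h1 y hy); omega) _
    refine le_trans ?_ (Finset.single_le_sum hnn hx)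
    have h5 := hpos x (h1 x hx)
    have h6 : 1 ≤ N x := Nat.one_le_iff_ne_zero.2 (Finsupp.mem_support_iff.1 hx)
    rw [map_nsmul, nsmul_eq_mul]
    exact le_mul_of_one_le_left (by omega) (by exact_mod_cast h6)

end Assembly

end ClosedForm

theorem mainTheorem9 {K : Type*} [Field K] [CharZero K] {r : ℕ} (hr : 1 ≤ r) (d : ℕ)
    (P : Polynomial (ClosedForm.PS r K)) (hP : P ≠ 0) (hd : P.natDegree ≤ d)
    (hsimple : ClosedForm.OnlySimpleRoots P)
    (y₀ : ClosedForm.PS r K) (hy₀ : P.eval y₀ = 0)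
    (k : ClosedForm.Expo r)
    (hk : (ClosedForm.discrim P).order + 1 ≤ (k.degree : ℕ∞)) :
    (ClosedForm.iota P y₀ (ClosedForm.grSucc (ClosedForm.kZero P y₀)) +
        ClosedForm.grSucc (ClosedForm.kZero P y₀) =
      ClosedForm.iota P y₀ (ClosedForm.kZero P y₀) +
        ClosedForm.grSucc (ClosedForm.grSucc (ClosedForm.kZero P y₀))) ∧
    ClosedForm.omegaZero P y₀ ≠ 0 ∧
    ∀ p : ClosedForm.Expo r, toDegLex (ClosedForm.grSucc k) < toDegLex p →
      ∀ n : Fin r → ℤ, n = ClosedForm.toZ p - ClosedForm.toZ (ClosedForm.grSucc k) →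
      BddAbove (ClosedForm.muSet P y₀ k n) ∧
      (∀ q : ℕ, 1 ≤ q →
        {ST : ((ClosedForm.Expo r × ℕ) →₀ ℕ) × (ClosedForm.Expo r →₀ ℕ) |
          ST.1 ∈ ClosedForm.SIndex r d q ∧
          ST.2 ∈ ClosedForm.TIndex (ClosedForm.grSucc k) (ClosedForm.iota P y₀ k) n q
            ST.1}.Finite ∧
        ∀ S ∈ ClosedForm.SIndex r d q,
          ∀ T ∈ ClosedForm.TIndex (ClosedForm.grSucc k) (ClosedForm.iota P y₀ k) n q S,
            (ClosedForm.ETuples d (ClosedForm.grSucc k) (ClosedForm.iota P y₀ k) q S T).Finite ∧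
            ∃ N : ℕ, (1 / (q : ℚ)) * ClosedForm.eCoeff d (ClosedForm.grSucc k)
              (ClosedForm.iota P y₀ k) q S T = (N : ℚ)) ∧
      MvPowerSeries.coeff p y₀ =
        ∑ q ∈ Finset.Icc 1 (ClosedForm.mu P y₀ k n),
          (1 / (q : K)) * (-1 / ClosedForm.omegaZero P y₀) ^ q *
            ∑ᶠ S ∈ ClosedForm.SIndex r d q,
              ClosedForm.monA P S *
                ∑ᶠ T ∈ ClosedForm.TIndex (ClosedForm.grSucc k) (ClosedForm.iota P y₀ k) n q S,
                  ((ClosedForm.eCoeff d (ClosedForm.grSucc k) (ClosedForm.iota P y₀ k) q S T : ℚ) :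
                    K) * ClosedForm.monC y₀ T := by
  open ClosedForm in
  obtain ⟨h0, hω, hG⟩ := kZero_spec hr hP hy₀ hk
  refine ⟨h0, hω, ?_⟩
  rintro p hp n rfl
  -- a linear form compatible with the order on the exponents beyond `i_k` and beyond `S(k)`
  obtain ⟨w, hw, hlt⟩ := exists_weight r (max (iota P y₀ k).degree (grSucc k).degree)
  have hι : ∀ e, toDegLex (iota P y₀ k) < toDegLex e →
      weightHom w (toZ (iota P y₀ k)) <
        weightHom w (toZ e) := by
    intro e he
    rw [weightHom_toZ, weightHom_toZ]
    exact_mod_cast hlt _ _ (le_max_left _ _) he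
  have hS : ∀ e, toDegLex (grSucc k) < toDegLex e →
      weightHom w (toZ (grSucc k)) <
        weightHom w (toZ e) := by
    intro e he
    rw [weightHom_toZ, weightHom_toZ]
    exact_mod_cast hlt _ _ (le_max_right _ _) he
  have hQ : ∀ l m, coeffQ P y₀ k l m ≠ 0 → 1 ≤ weightHom w l := by
    intro l m hl
    obtain ⟨e, he, hlt'⟩ := exists_of_coeffQ_ne_zero hr hω hG hl
    have := hι e hlt'
    rw [he, map_add] at this
    omega
  set n := toZ p - toZ (grSucc k) with hn
  set N := (weightHom w n).toNat with hN
  have hnN : weightHom w n ≤ N := Int.self_le_toNat _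
  have hbdd : ∀ q ∈ muSet P y₀ k n, q ≤ N := le_of_mem_muSet hQ hnN
  refine ⟨⟨N, hbdd⟩, fun q hq => ⟨finite_SIndex_TIndex _ _ _ _ _,
    fun S _ T hT => ⟨finite_ETuples _ _ _,
      exists_natCast_eq_eCoeff hq hT⟩⟩, ?_⟩
  have hroot : (remainderRoot y₀ k).coeff n = MvPowerSeries.coeff p y₀ :=
    coeff_remainderRoot (by rw [hn, sub_add_cancel]) hp
  have hζ : WeightGE (weightHom w) 0 (remainderRoot y₀ k) := by
    intro l hl
    obtain ⟨e, he, hlt'⟩ := exists_of_coeff_remainderRoot_ne_zero hl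
    have := hS e hlt'
    rw [he, map_add] at this
    omega
  rw [← hroot, coeff_eq_sum_coeff_pow
    (fun m l hl => hQ l m (by rwa [coeff_fixedPointPoly hr] at hl)) hζ
    (eval_fixedPointPoly hy₀ k) hnN]
  have hmu : mu P y₀ k n ≤ N := by
    rcases (muSet P y₀ k n).eq_empty_or_nonempty with he | hne
    · rw [mu, he]; simp
    · exact csSup_le hne hbdd
  -- by maximality of `μ_n`, the powers beyond it do not contribute
  rw [← Finset.sum_subset (Finset.Icc_subset_Icc_right hmu)]
  · refine Finset.sum_congr rfl fun q hq => ?_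
    rw [coeff_fixedPointPoly_pow hr hd hω hG hw hι n (Finset.mem_Icc.1 hq).1, mul_assoc]
  · intro q hq hq'
    rw [Finset.mem_Icc] at hq hq'
    by_contra hne
    obtain ⟨M, hM, h1, h2, h3⟩ :=
      exists_tuple_of_coeff_pow_ne_zero (right_ne_zero_of_mul hne)
    refine hq' ⟨hq.1, le_csSup ⟨N, hbdd⟩ ⟨M, fun x hx => ?_, h1, by omega, h3⟩⟩
    rw [← coeff_fixedPointPoly hr]
    exact hM x hx
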